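/- **Setting.** Let $p:\mathbb R\to\mathbb R$ and $\tau:\mathbb R\to[0,\infty)$ be Lebesgue measurable and essentially bounded, with $\operatorname{ess\,sup}_{t\in\mathbb R}|p(t)|\le 1$. Let $s\in\mathbb R$ and $\tau_m:=\operatorname{ess\,sup}\{\tau(t):t\ge s\}$. A solution of $$x''(t)+p(t)\,x(t-\tau(t))=0,\qquad t\ge s, \tag{1}$$ is a function $x:[s-\tau_m,\infty)\to\mathbb R$ that is (locally) absolutely continuous together with its first derivative and satisfies (1) for almost every $t\ge s$. It is oscillatory if it has arbitrarily large zeros. A semicycle of $x$ is an interval $(a,b)$, $a<b$, between adjacent zeros: $x(a)=x(b)=0$ and $x(t)\neq0$ for $t\in(a,b)$. **The constants.** For $\Delta\ge0$ let $r_\Delta$ be the solution of $r_\Delta''(t)+r_\Delta(t-\Delta)=0$ for $t\ge0$ with $r_\Delta(t)=1$ for $t\le0$ and $r_\Delta'(0)=0$, and let $\vartheta_\Delta$ be its first zero. For $\rho>0$ put $\beta_0\equiv1$ on $(-\infty,0]$ and, for $n\ge0$, $$g_n(v)=\max\{\beta_n(v),\ \rho\, r_\Delta(\vartheta_\Delta-v-\Delta)\,\chi_{[-\Delta,0]}(v)\},$$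 let $\varpi_n>0$ be the unique number with $\int_{-\varpi_n}^0\int_{-\varpi_n}^{s}g_n(w)\,dw\,ds=1$, and let $\beta_{n+1}(t)=1$ for $t\le-\varpi_n$ and $\beta_{n+1}(t)=1-\int_{-\varpi_n}^t\int_{-\varpi_n}^s g_n(v)\,dv\,ds$ for $-\varpi_n\le t\le0$. The sequence $\varpi_n$ is nondecreasing and bounded; set $\Psi(\rho,\Delta):=\lim_{n\to\infty}\varpi_n$. **Theorem 10.41.** Let $x$ be an oscillatory solution of (1). (i) If $\tau_m>0$, assume that every semicycle $(a,b)$ of $x$ satisfies $b-a\le\Psi(1,\tau_m)+\vartheta_{\tau_m}$; if $\tau_m=0$, assume that every semicycle $(a,b)$ of $x$ satisfies $b-a<\pi$. Then $x$ is bounded. (ii) If there is a real constant $c\in(0,\Psi(1,\tau_m)+\vartheta_{\tau_m})$ such that every semicycle $(a,b)$ of $x$ satisfies $b-a<c$, then $x(t)\to0$ as $t\to\infty$. -/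

import Mathlib

open Set Filter Topology MeasureTheory

noncomputable section

namespace DelayEq

/-! ### The comparison solution `r_Δ` -/

/-- `r` solves `r'' (t) + r (t - Δ) = 0` for `t ≥ 0`, with `r t = 1` for `t ≤ 0` and `r' 0 = 0`;
`v` is the derivative of `r` on `[0, ∞)` (one-sided at `0`). -/
structure IsComparisonSolution (Δ : ℝ) (r : ℝ → ℝ) : Prop where
  init : ∀ t ≤ 0, r t = 1
  ode : ∃ v : ℝ → ℝ, v 0 = 0 ∧ (∀ t ≥ 0, HasDerivWithinAt r (v t) (Ici 0) t) ∧
    ∀ t ≥ 0, HasDerivWithinAt v (-(r (t - Δ))) (Ici 0) t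

lemma hasDerivAt_max_pow (n : ℕ) (a t : ℝ) :
    HasDerivAt (fun y : ℝ => (max (y - a) 0) ^ (n + 2))
      ((n + 2) * (max (t - a) 0) ^ (n + 1)) t := by
  rcases lt_trichotomy t a with h | h | h
  · have h1 : (fun y : ℝ => (max (y - a) 0) ^ (n + 2)) =ᶠ[𝓝 t] fun _ => (0 : ℝ) := by
      filter_upwards [Iio_mem_nhds h] with y hy
      have : max (y - a) 0 = 0 := max_eq_right (by linarith [mem_Iio.1 hy])
      simp [this]
    have h2 : max (t - a) 0 = 0 := max_eq_right (by linarith)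
    rw [h2]
    simpa using (hasDerivAt_const t (0 : ℝ)).congr_of_eventuallyEq h1
  · subst h
    have h2 : max (t - t) 0 = 0 := by simp
    rw [h2]
    have : HasDerivAt (fun y : ℝ => (max (y - t) 0) ^ (n + 2)) 0 t := by
      rw [hasDerivAt_iff_isLittleO]
      simp only [sub_self, max_self, smul_zero, sub_zero, ne_eq, Nat.add_eq_zero_iff,
        OfNat.ofNat_ne_zero, and_false, not_false_eq_true, zero_pow]
      have hO : (fun y : ℝ => (max (y - t) 0) ^ (n + 2)) =O[𝓝 t]
          fun y : ℝ => (y - t) ^ (n + 2) := by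
        refine Asymptotics.IsBigO.of_bound 1 (Eventually.of_forall fun y => ?_)
        rw [one_mul, norm_pow, norm_pow]
        gcongr
        rw [Real.norm_eq_abs, Real.norm_eq_abs, abs_of_nonneg (le_max_right _ _)]
        exact max_le (le_abs_self _) (abs_nonneg _)
      refine hO.trans_isLittleO ?_
      have ho : (fun u : ℝ => u ^ (n + 2)) =o[𝓝 0] fun u : ℝ => u := by
        simpa using Asymptotics.isLittleO_pow_pow (𝕜 := ℝ) (m := 1) (n := n + 2) (by omega)
      have ht : Tendsto (fun y : ℝ => y - t) (𝓝 t) (𝓝 0) := by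
        have : ContinuousAt (fun y : ℝ => y - t) t := by fun_prop
        simpa [ContinuousAt] using this
      exact ho.comp_tendsto ht
    simpa using this
  · have h1 : (fun y : ℝ => (max (y - a) 0) ^ (n + 2)) =ᶠ[𝓝 t] fun y => (y - a) ^ (n + 2) := by
      filter_upwards [Ioi_mem_nhds h] with y hy
      rw [max_eq_left (by linarith [mem_Ioi.1 hy])]
    have h2 : max (t - a) 0 = t - a := max_eq_left (by linarith)
    rw [h2]
    have := ((hasDerivAt_id t).sub_const a).pow (n + 2)
    refine HasDerivAt.congr_of_eventuallyEq ?_ h1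
    convert! this using 1
    simp

/-- The terms, with index shifted by one, of the series for `r_Δ`. -/
def seriesTerm (Δ : ℝ) (k : ℕ) (t : ℝ) : ℝ :=
  (-1) ^ (k + 1) / ((2 * k + 2).factorial : ℝ) * (max (t - k * Δ) 0) ^ (2 * k + 2)

/-- The derivative of `seriesTerm`. -/
def seriesTerm' (Δ : ℝ) (k : ℕ) (t : ℝ) : ℝ :=
  (-1) ^ (k + 1) / ((2 * k + 1).factorial : ℝ) * (max (t - k * Δ) 0) ^ (2 * k + 1)

/-- `r_Δ t = ∑_{k ≥ 0} (-1)^k / (2k)! * (max (t - (k-1)Δ) 0)^(2k)`, a sum which for `Δ > 0` is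
finite and for `Δ = 0`, `t ≥ 0` is `cos t`. -/
def comparisonSeries (Δ t : ℝ) : ℝ := 1 + ∑' k, seriesTerm Δ k t

lemma hasDerivAt_seriesTerm (Δ : ℝ) (k : ℕ) (t : ℝ) :
    HasDerivAt (seriesTerm Δ k) (seriesTerm' Δ k t) t := by
  have h := (hasDerivAt_max_pow (2 * k) (k * Δ) t).const_mul
    ((-1) ^ (k + 1) / ((2 * k + 2).factorial : ℝ))
  unfold seriesTerm seriesTerm'
  convert! h using 1
  have h1 : ((2 * k + 2).factorial : ℝ) = (2 * k + 2) * ((2 * k + 1).factorial : ℝ) := by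
    rw [Nat.factorial_succ (2 * k + 1)]; push_cast; ring
  have h2 : ((2 * k + 1).factorial : ℝ) ≠ 0 := by positivity
  have h3 : (2 * (k : ℝ) + 2) ≠ 0 := by positivity
  rw [h1]
  push_cast
  field_simp

lemma hasDerivAt_seriesTerm'_succ (Δ : ℝ) (k : ℕ) (t : ℝ) :
    HasDerivAt (seriesTerm' Δ (k + 1)) (-(seriesTerm Δ k (t - Δ))) t := by
  have h := (hasDerivAt_max_pow (2 * k + 1) ((k + 1 : ℕ) * Δ) t).const_mul
    ((-1) ^ (k + 1 + 1) / ((2 * (k + 1) + 1).factorial : ℝ))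
  unfold seriesTerm seriesTerm'
  convert! h using 1
  have h1 : ((2 * (k + 1) + 1).factorial : ℝ) = (2 * k + 3) * ((2 * k + 2).factorial : ℝ) := by
    rw [Nat.factorial_succ (2 * (k + 1))]; push_cast; ring_nf
  have h2 : ((2 * k + 2).factorial : ℝ) ≠ 0 := by positivity
  have h3 : (2 * (k : ℝ) + 3) ≠ 0 := by positivity
  have h4 : t - Δ - k * Δ = t - (k + 1 : ℕ) * Δ := by push_cast; ring
  rw [h1, h4]
  push_cast
  field_simp
  ring

lemma max_sub_le {Δ : ℝ} (hΔ : 0 ≤ Δ) (k : ℕ) {T t : ℝ} (hT : 0 ≤ T) (ht : t ≤ T) :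
    max (t - k * Δ) 0 ≤ T :=
  max_le (by have : 0 ≤ (k : ℝ) * Δ := by positivity
             linarith) hT

lemma norm_seriesTerm_le {Δ : ℝ} (hΔ : 0 ≤ Δ) (k : ℕ) {T t : ℝ} (hT : 0 ≤ T) (ht : t ≤ T) :
    ‖seriesTerm Δ k t‖ ≤ T ^ (2 * k + 2) / ((2 * k + 2).factorial : ℝ) := by
  have h := max_sub_le hΔ k hT ht
  have h0 : 0 ≤ max (t - k * Δ) 0 := le_max_right _ _
  rw [seriesTerm, norm_mul, norm_div, norm_pow, norm_neg, norm_one, one_pow, norm_pow,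
    Real.norm_of_nonneg h0, Real.norm_of_nonneg (by positivity), one_div_mul_eq_div]
  gcongr

lemma norm_seriesTerm'_le {Δ : ℝ} (hΔ : 0 ≤ Δ) (k : ℕ) {T t : ℝ} (hT : 0 ≤ T) (ht : t ≤ T) :
    ‖seriesTerm' Δ k t‖ ≤ T ^ (2 * k + 1) / ((2 * k + 1).factorial : ℝ) := by
  have h := max_sub_le hΔ k hT ht
  have h0 : 0 ≤ max (t - k * Δ) 0 := le_max_right _ _
  rw [seriesTerm', norm_mul, norm_div, norm_pow, norm_neg, norm_one, one_pow, norm_pow,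
    Real.norm_of_nonneg h0, Real.norm_of_nonneg (by positivity), one_div_mul_eq_div]
  gcongr

lemma summable_even (T : ℝ) :
    Summable fun k : ℕ => T ^ (2 * k + 2) / ((2 * k + 2).factorial : ℝ) :=
  (Real.summable_pow_div_factorial T).comp_injective (i := fun k : ℕ => 2 * k + 2)
    (fun a b h => by simpa using h)

lemma summable_odd (T : ℝ) :
    Summable fun k : ℕ => T ^ (2 * k + 1) / ((2 * k + 1).factorial : ℝ) :=
  (Real.summable_pow_div_factorial T).comp_injective (i := fun k : ℕ => 2 * k + 1)
    (fun a b h => by simpa using h)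

lemma summable_seriesTerm {Δ : ℝ} (hΔ : 0 ≤ Δ) (t : ℝ) :
    Summable fun k => seriesTerm Δ k t :=
  .of_norm_bounded (summable_even |t|)
    fun k => norm_seriesTerm_le hΔ k (abs_nonneg t) (le_abs_self t)

lemma summable_seriesTerm' {Δ : ℝ} (hΔ : 0 ≤ Δ) (t : ℝ) :
    Summable fun k => seriesTerm' Δ k t :=
  .of_norm_bounded (summable_odd |t|)
    fun k => norm_seriesTerm'_le hΔ k (abs_nonneg t) (le_abs_self t)

/-- The series solves the initial value problem. -/
theorem isComparisonSolution_series {Δ : ℝ} (hΔ : 0 ≤ Δ) :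
    IsComparisonSolution Δ (comparisonSeries Δ) := by
  refine ⟨fun t ht => ?_, fun t => ∑' k, seriesTerm' Δ k t, ?_, fun t ht => ?_, fun t ht => ?_⟩
  · have : ∀ k, seriesTerm Δ k t = 0 := fun k => by
      have : max (t - k * Δ) 0 = 0 := le_antisymm (max_sub_le hΔ k le_rfl ht) (le_max_right _ _)
      simp [seriesTerm, this]
    simp [comparisonSeries, this]
  · have : ∀ k, seriesTerm' Δ k 0 = 0 := fun k => by
      have : max (0 - k * Δ) 0 = 0 :=
        le_antisymm (max_sub_le hΔ k le_rfl le_rfl) (le_max_right _ _)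
      simp only [seriesTerm', this]
      simp
    simp [this]
  · have h := hasDerivAt_tsum_of_isPreconnected (summable_odd (t + 1)) isOpen_Iio
      isPreconnected_Iio (fun n y (_ : y ∈ Iio (t + 1)) => hasDerivAt_seriesTerm Δ n y)
      (fun n y hy => norm_seriesTerm'_le hΔ n (by linarith) (mem_Iio.1 hy).le)
      (y₀ := t) (by simp) (summable_seriesTerm hΔ t) (y := t) (by simp)
    exact (h.const_add 1).hasDerivWithinAt
  · have h := hasDerivAt_tsum_of_isPreconnected (summable_even (t + 1)) isOpen_Iio
      isPreconnected_Iio (fun n y (_ : y ∈ Iio (t + 1)) => hasDerivAt_seriesTerm'_succ Δ n y)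
      (fun n y hy => by
        rw [norm_neg]
        exact norm_seriesTerm_le hΔ n (by linarith) (by linarith [mem_Iio.1 hy]))
      (y₀ := t) (by simp) ((summable_nat_add_iff 1).2 (summable_seriesTerm' hΔ t)) (y := t)
      (by simp)
    have h1 : ∀ y ∈ Ici (0 : ℝ), ∑' k, seriesTerm' Δ k y =
        -y + ∑' k, seriesTerm' Δ (k + 1) y := fun y hy => by
      rw [(summable_seriesTerm' hΔ y).tsum_eq_zero_add]
      simp [seriesTerm', mem_Ici.1 hy]
    have h2 := ((hasDerivAt_id t).neg.add h).hasDerivWithinAt (s := Ici 0)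
    have h3 : -comparisonSeries Δ (t - Δ) = -1 + ∑' k, -(seriesTerm Δ k (t - Δ)) := by
      rw [comparisonSeries, tsum_neg]; ring
    rw [h3]
    exact h2.congr (fun y hy => h1 y hy) (h1 t ht)

/-- The initial value problem has at most one solution. -/
theorem IsComparisonSolution.unique {Δ : ℝ} (hΔ : 0 ≤ Δ) {r q : ℝ → ℝ}
    (hr : IsComparisonSolution Δ r) (hq : IsComparisonSolution Δ q) : r = q := by
  obtain ⟨v, v0, hv, hv'⟩ := hr.ode
  obtain ⟨w, w0, hw, hw'⟩ := hq.ode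
  have key : ∀ n : ℕ, (∀ t ≤ (n : ℝ) / 2, r t = q t) ∧
      v ((n : ℝ) / 2) = w ((n : ℝ) / 2) := by
    intro n
    induction n with
    | zero =>
      refine ⟨fun t ht => ?_, by simp [v0, w0]⟩
      have ht : t ≤ 0 := by simpa using ht
      rw [hr.init t ht, hq.init t ht]
    | succ n ih =>
      obtain ⟨ih1, ih2⟩ := ih
      set a : ℝ := (n : ℝ) / 2 with ha
      have ha0 : 0 ≤ a := by positivity
      have hb : ((n + 1 : ℕ) : ℝ) / 2 = a + 1 / 2 := by rw [ha]; push_cast; ring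
      rw [hb]
      have hsub : Icc a (a + 1 / 2) ⊆ Ici 0 := fun y hy => ha0.trans hy.1
      have du : ∀ t ∈ Icc a (a + 1 / 2),
          HasDerivWithinAt (fun t => r t - q t) (v t - w t) (Icc a (a + 1 / 2)) t := fun t ht =>
        ((hv t (hsub ht)).sub (hw t (hsub ht))).mono hsub
      have dw : ∀ t ∈ Icc a (a + 1 / 2),
          HasDerivWithinAt (fun t => v t - w t) (-(r (t - Δ)) - -(q (t - Δ)))
            (Icc a (a + 1 / 2)) t := fun t ht =>
        ((hv' t (hsub ht)).sub (hw' t (hsub ht))).mono hsub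
      have hc : ContinuousOn (fun t => |r t - q t|) (Icc a (a + 1 / 2)) :=
        ContinuousOn.abs fun t ht => (du t ht).continuousWithinAt
      obtain ⟨m, hm, hmax⟩ := isCompact_Icc.exists_isMaxOn
        (nonempty_Icc.2 (by linarith : a ≤ a + 1 / 2)) hc
      set M := |r m - q m| with hM
      have hM0 : 0 ≤ M := abs_nonneg _
      have hle : ∀ t ≤ a + 1 / 2, |r t - q t| ≤ M := fun t ht => by
        rcases le_total t a with h | h
        · rw [ih1 t h]; simpa using hM0
        · exact hmax ⟨h, ht⟩
      have b1 : ∀ t ∈ Icc a (a + 1 / 2), |v t - w t| ≤ M / 2 := fun t ht => by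
        have := norm_image_sub_le_of_norm_deriv_le_segment' dw (C := M) (fun y hy => by
          have := hle (y - Δ) (by linarith [hy.2])
          rw [Real.norm_eq_abs, ← abs_neg]
          convert! this using 2; ring) t ht
        rw [ih2, sub_self, sub_zero, Real.norm_eq_abs] at this
        nlinarith [ht.2]
      have b2 : ∀ t ∈ Icc a (a + 1 / 2), |r t - q t| ≤ M / 4 := fun t ht => by
        have := norm_image_sub_le_of_norm_deriv_le_segment' du (C := M / 2)
          (fun y hy => b1 y ⟨hy.1, hy.2.le⟩) t ht
        rw [ih1 a le_rfl, sub_self, sub_zero, Real.norm_eq_abs] at this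
        nlinarith [ht.2]
      have hMz : M = 0 := by linarith [b2 m hm]
      refine ⟨fun t ht => ?_, ?_⟩
      · have := hle t ht
        rw [hMz] at this
        exact sub_eq_zero.1 (abs_nonpos_iff.1 this)
      · have := b1 (a + 1 / 2) ⟨by linarith, le_rfl⟩
        rw [hMz, zero_div] at this
        exact sub_eq_zero.1 (abs_nonpos_iff.1 this)
  funext t
  obtain ⟨n, hn⟩ := exists_nat_ge (2 * t)
  exact (key n).1 t (by linarith)

/-- `r_Δ`, the solution of the initial value problem (used for `Δ ≥ 0`). -/
def comparisonSol (Δ : ℝ) : ℝ → ℝ := Classical.epsilon (IsComparisonSolution Δ)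

theorem isComparisonSolution_comparisonSol {Δ : ℝ} (hΔ : 0 ≤ Δ) :
    IsComparisonSolution Δ (comparisonSol Δ) :=
  Classical.epsilon_spec ⟨_, isComparisonSolution_series hΔ⟩

/-- `ϑ_Δ`, the first zero of `r_Δ`. -/
def firstZero (Δ : ℝ) : ℝ := sInf {t : ℝ | 0 ≤ t ∧ comparisonSol Δ t = 0}

/-! ### The functions `β_n`, the numbers `ϖ_n` and their limit `Ψ (ρ, Δ)` -/

/-- `max {β v, ρ r_Δ (ϑ_Δ - v - Δ) χ_[-Δ,0] v}`. -/
def forcing (ρ Δ : ℝ) (β : ℝ → ℝ) (v : ℝ) : ℝ :=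
  max (β v) (ρ * comparisonSol Δ (firstZero Δ - v - Δ) * indicator (Icc (-Δ) 0) (fun _ => 1) v)

/-- `h v = ∫_v^0 ∫_v^s max {β w, ρ r_Δ (ϑ_Δ - w - Δ) χ_[-Δ,0] w} dw ds`, for `v ≤ 0`. -/
def doubleIntegral (ρ Δ : ℝ) (β : ℝ → ℝ) (v : ℝ) : ℝ :=
  ∫ s in v..0, ∫ w in v..s, forcing ρ Δ β w

/-- The positive number `ϖ` with `h (-ϖ) = 1` (it is unique for the functions `β_n` below). -/
def hitLength (ρ Δ : ℝ) (β : ℝ → ℝ) : ℝ :=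
  sInf {w : ℝ | 0 < w ∧ doubleIntegral ρ Δ β (-w) = 1}

/-- The functions `β_n`. Only their values on `(-∞, 0]` are meaningful and used. -/
def betaSeq (ρ Δ : ℝ) : ℕ → ℝ → ℝ
  | 0 => fun _ => 1
  | n + 1 => fun t =>
      if t ≤ -(hitLength ρ Δ (betaSeq ρ Δ n)) then 1
      else 1 - ∫ s in (-(hitLength ρ Δ (betaSeq ρ Δ n)))..t,
        ∫ v in (-(hitLength ρ Δ (betaSeq ρ Δ n)))..s, forcing ρ Δ (betaSeq ρ Δ n) v

/-- The sequence `ϖ_n`. -/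
def varpi (ρ Δ : ℝ) (n : ℕ) : ℝ := hitLength ρ Δ (betaSeq ρ Δ n)

/-- `Ψ (ρ, Δ)`, the limit of the (nondecreasing, bounded) sequence `ϖ_n`. -/
def Psi (ρ Δ : ℝ) : ℝ := limUnder atTop (varpi ρ Δ)

/-! ### The delay equation -/

/-- `τ_m`, the essential supremum of the delay on `[s, ∞)`. -/
def maxDelay (τ : ℝ → ℝ) (s : ℝ) : ℝ := essSup τ (volume.restrict (Ici s))

/-- `x`, a function on `[s - τ_m, ∞)` (its values elsewhere are ignored), is a solution of
`x'' (t) + p t * x (t - τ t) = 0`, `t ≥ s`: `x` is differentiable, with derivative `x'`, both are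
locally absolutely continuous on `[s - τ_m, ∞)`, and the equation holds a.e. on `[s, ∞)`. -/
def IsSolution (p τ : ℝ → ℝ) (s : ℝ) (x : ℝ → ℝ) : Prop :=
  ∃ x' : ℝ → ℝ,
    (∀ t ∈ Ici (s - maxDelay τ s), HasDerivWithinAt x (x' t) (Ici (s - maxDelay τ s)) t) ∧
    (∀ T ≥ s - maxDelay τ s, AbsolutelyContinuousOnInterval x (s - maxDelay τ s) T) ∧
    (∀ T ≥ s - maxDelay τ s, AbsolutelyContinuousOnInterval x' (s - maxDelay τ s) T) ∧
    ∀ᵐ t ∂(volume.restrict (Ici s)), HasDerivAt x' (-(p t * x (t - τ t))) t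

/-- `x : A → ℝ` has arbitrarily large zeros. -/
def IsOscillatory (A : Set ℝ) (x : ℝ → ℝ) : Prop := ∀ T : ℝ, ∃ t ∈ A, T ≤ t ∧ x t = 0

/-- `(a, b)` is a semicycle of `x : A → ℝ`: `a < b` are adjacent zeros of `x`. -/
def IsSemicycle (A : Set ℝ) (x : ℝ → ℝ) (a b : ℝ) : Prop :=
  a ∈ A ∧ b ∈ A ∧ a < b ∧ x a = 0 ∧ x b = 0 ∧ ∀ t ∈ Ioo a b, x t ≠ 0

end DelayEq

end

/-!
Only the inequality `|x'' t| ≤ |x θ|` with some `θ ∈ [t - Δ, t]`, `Δ = τ_m`, matters (`DelayIneq`).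
Suppose that `|x| ≤ 1` up to the end of a semicycle `(a, b)` on which `x > 0`, and let `ξ` be a
maximum point of `x` in it. Two estimates control the two halves of the semicycle.

*The falling part.* A solution bounded by `1` can approach a zero no faster than `r_Δ` does:
`|x t| ≤ r_Δ (ϑ_Δ - (b - t))` (`DelayIneq.abs_le_comparisonSol`, by sliding a translate of `r_Δ`
until it touches the graph of `|x|`). So `b - ξ ≥ ϑ_Δ` if `x ξ = 1`, with quantitative versions if
`x ξ < 1`.

*The rising part.* The same estimate at the zero `a` bounds the values before `a` that the delay can
reach from `(a, ξ)`. The values after `a` are bounded by `β_n`, by induction on `n`: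
`x (a - v) ≤ β_n v` (`DelayIneq.le_betaSeq`), since the difference of the two sides is convex in
`v`. Integrating twice between `a` and the critical point `ξ` gives
`x ξ ≤ ∫_{a-ξ}^0 (-v) g_n v dv` (`DelayIneq.le_doubleIntegral`), where the right-hand side is less
than `1` as long as `ξ - a < ϖ_n`. So `ξ - a ≥ Ψ` if `x ξ = 1`.

If all semicycles are shorter than some `c < Ψ + ϑ_Δ`, one of the two estimates yields a factor
`q < 1`, depending only on `c`, by which the maximum over a semicycle is smaller than the supremum
of `|x|` on the preceding history (`exists_contraction`); hence `x → 0`. If the semicycles are only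
bounded by `Ψ + ϑ_Δ` and `x` is unbounded, then some semicycle attains a maximum that is strictly
larger than all values before it. For `Δ > 0` the forcing `g_n` then strictly overestimates the
reachable values near `a`, which makes the semicycle strictly longer than `Ψ + ϑ_Δ`
(`DelayIneq.lt_sub_of_isMax`). For `Δ = 0` Sturm comparison shows that no semicycle is shorter than
`π` (`DelayIneq.pi_le_sub`).

The limit `Ψ` exists because the `ϖ_n` increase and the `β_n` stay above `-sin`, the fixed point of
the step without the term `r_Δ`, so that `ϖ_n ≤ π / 2` (`tendsto_varpi`).
-/

namespace DelayEq

/-! ### Calculus on an interval -/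

lemma monotoneOn_Icc_of_hasDerivWithinAt {f f' : ℝ → ℝ} {a b : ℝ}
    (hf : ∀ t ∈ Icc a b, HasDerivWithinAt f (f' t) (Icc a b) t) (h : ∀ t ∈ Icc a b, 0 ≤ f' t) :
    MonotoneOn f (Icc a b) :=
  monotoneOn_of_hasDerivWithinAt_nonneg (convex_Icc a b)
    (fun t ht => (hf t ht).continuousWithinAt)
    (fun t ht => (hf t (interior_subset ht)).mono interior_subset)
    fun t ht => h t (interior_subset ht)

lemma convexOn_Icc_of_hasDerivWithinAt {f f' : ℝ → ℝ} {a b : ℝ}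
    (hf : ∀ t ∈ Icc a b, HasDerivWithinAt f (f' t) (Icc a b) t) (h : MonotoneOn f' (Icc a b)) :
    ConvexOn ℝ (Icc a b) f := by
  have hd : ∀ t ∈ interior (Icc a b), HasDerivAt f (f' t) t := fun t ht =>
    (hf t (interior_subset ht)).hasDerivAt (mem_interior_iff_mem_nhds.1 ht)
  refine MonotoneOn.convexOn_of_deriv (convex_Icc a b)
    (fun t ht => (hf t ht).continuousWithinAt)
    (fun t ht => (hd t ht).differentiableAt.differentiableWithinAt) fun t ht u hu htu => ?_
  rw [(hd t ht).deriv, (hd u hu).deriv]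
  exact h (interior_subset ht) (interior_subset hu) htu

/-- Cauchy's formula for a repeated integral. -/
lemma integral_integral_eq {f : ℝ → ℝ} (hf : ∀ a b, IntervalIntegrable f volume a b) (a b : ℝ) :
    ∫ s in a..b, ∫ v in a..s, f v = ∫ v in a..b, (b - v) * f v := by
  have hF : AbsolutelyContinuousOnInterval (fun s => ∫ v in a..s, f v) a b :=
    (hf a b).absolutelyContinuousOnInterval_intervalIntegral (by simp)
  have hG : AbsolutelyContinuousOnInterval (fun s : ℝ => b - s) a b :=
    (contDiff_const.sub contDiff_id).contDiffOn.absolutelyContinuousOnInterval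
  have h := hF.integral_mul_deriv_eq_deriv_mul hG
  have h1 : ∀ s : ℝ, deriv (fun s : ℝ => b - s) s = -1 := fun s => by simp
  have h2 : ∫ x in a..b, deriv (fun s => ∫ v in a..s, f v) x * (b - x)
      = ∫ v in a..b, (b - v) * f v := by
    refine intervalIntegral.integral_congr_ae ?_
    filter_upwards [(hf a b).ae_hasDerivAt_integral] with t ht ht'
    rw [(ht (uIoc_subset_uIcc ht') a (by simp)).deriv, mul_comm]
  simp only [h1, h2, intervalIntegral.integral_same] at h
  simp only [mul_neg, mul_one, intervalIntegral.integral_neg] at h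
  linarith

lemma hasDerivAt_integral_integral {f : ℝ → ℝ} (hf : ∀ a b, IntervalIntegrable f volume a b)
    (a t : ℝ) : HasDerivAt (fun t => ∫ s in a..t, ∫ v in a..s, f v) (∫ v in a..t, f v) t := by
  have hc := intervalIntegral.continuous_primitive hf a
  exact intervalIntegral.integral_hasDerivAt_right (hc.intervalIntegrable _ _)
    hc.stronglyMeasurable.stronglyMeasurableAtFilter hc.continuousAt

/-! ### The comparison solution -/

lemma exists_hasDerivAt_comparisonSol {Δ : ℝ} (hΔ : 0 ≤ Δ) :
    ∃ v : ℝ → ℝ, (∀ t, HasDerivAt (comparisonSol Δ) (v t) t) ∧ (∀ t ≤ 0, v t = 0) ∧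
      ∀ t ≥ 0, HasDerivWithinAt v (-(comparisonSol Δ (t - Δ))) (Ici 0) t := by
  obtain ⟨hinit, v, v0, hv, hv'⟩ := isComparisonSolution_comparisonSol hΔ
  have hI : ∀ t ≤ 0, HasDerivWithinAt (comparisonSol Δ) 0 (Iic 0) t := fun t ht =>
    (hasDerivWithinAt_const t (Iic 0) (1 : ℝ)).congr (fun y hy => hinit y hy) (hinit t ht)
  refine ⟨fun t => if t ≤ 0 then 0 else v t, fun t => ?_, fun t ht => by simp [ht],
    fun t ht => ?_⟩
  · rcases lt_trichotomy t 0 with h | h | h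
    · simpa [h.le] using (hI t h.le).hasDerivAt (Iic_mem_nhds h)
    · subst h
      have := (hI 0 le_rfl).union (v0 ▸ hv 0 le_rfl)
      simpa using this
    · simpa [h.not_ge] using (hv t h.le).hasDerivAt (Ici_mem_nhds h)
  · have : ∀ y ∈ Ici (0 : ℝ), (if y ≤ 0 then 0 else v y) = v y := fun y hy => by
      split_ifs with h
      · rw [le_antisymm h hy, v0]
      · rfl
    exact (hv' t ht).congr this (this t ht)

lemma comparisonSol_of_nonpos {Δ : ℝ} (hΔ : 0 ≤ Δ) {t : ℝ} (ht : t ≤ 0) :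
    comparisonSol Δ t = 1 :=
  (isComparisonSolution_comparisonSol hΔ).init t ht

lemma continuous_comparisonSol {Δ : ℝ} (hΔ : 0 ≤ Δ) : Continuous (comparisonSol Δ) := by
  obtain ⟨v, hv, -⟩ := exists_hasDerivAt_comparisonSol hΔ
  exact continuous_iff_continuousAt.2 fun t => (hv t).continuousAt

/-- As long as `r_Δ` is positive, it is concave: its slope decreases. -/
lemma strictAntiOn_deriv_comparisonSol {Δ : ℝ} (hΔ : 0 ≤ Δ) {v : ℝ → ℝ}
    (hv : ∀ t ≥ 0, HasDerivWithinAt v (-(comparisonSol Δ (t - Δ))) (Ici 0) t) {b : ℝ}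
    (hpos : ∀ t < b, 0 < comparisonSol Δ t) : StrictAntiOn v (Icc 0 b) := by
  refine strictAntiOn_of_deriv_neg (convex_Icc 0 b)
    (fun t ht => (hv t ht.1).continuousWithinAt.mono Icc_subset_Ici_self) fun t ht => ?_
  rw [interior_Icc] at ht
  rw [((hv t ht.1.le).hasDerivAt (Ici_mem_nhds ht.1)).deriv]
  linarith [hpos (t - Δ) (by linarith [ht.2])]

lemma exists_comparisonSol_eq_zero {Δ : ℝ} (hΔ : 0 ≤ Δ) :
    ∃ t, 0 ≤ t ∧ comparisonSol Δ t = 0 := by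
  obtain ⟨v, hr, hv0, hv⟩ := exists_hasDerivAt_comparisonSol hΔ
  by_contra! hne
  have h0 := comparisonSol_of_nonpos hΔ (le_refl (0 : ℝ))
  have hpos : ∀ t, 0 < comparisonSol Δ t := fun t => by
    rcases le_total t 0 with h | h
    · rw [comparisonSol_of_nonpos hΔ h]; exact one_pos
    · by_contra! hneg
      obtain ⟨u, hu, hu'⟩ := intermediate_value_Icc' h
        (continuous_comparisonSol hΔ).continuousOn ⟨hneg, h0 ▸ zero_le_one⟩
      exact hne u hu.1 hu'
  have hanti : ∀ b, StrictAntiOn v (Icc 0 b) := fun b =>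
    strictAntiOn_deriv_comparisonSol hΔ hv fun t _ => hpos t
  have hv1 : v 1 < 0 := by
    have := hanti 1 (left_mem_Icc.2 zero_le_one) (right_mem_Icc.2 zero_le_one) zero_lt_one
    rwa [hv0 0 le_rfl] at this
  set B := 1 + comparisonSol Δ 1 / (-v 1) with hB
  have hB1 : 1 ≤ B := by
    have : 0 ≤ comparisonSol Δ 1 / (-v 1) := div_nonneg (hpos 1).le (by linarith)
    linarith
  have hmono : MonotoneOn (fun t => v 1 * t - comparisonSol Δ t) (Icc 1 B) := by
    refine monotoneOn_Icc_of_hasDerivWithinAt (f' := fun t => v 1 * 1 - v t)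
      (fun t ht => (((hasDerivAt_id t).const_mul (v 1)).sub (hr t)).hasDerivWithinAt)
      fun t ht => ?_
    have := (hanti B).antitoneOn (a := 1) (b := t) ⟨zero_le_one, hB1⟩
      ⟨by linarith [ht.1], ht.2⟩ ht.1
    linarith
  have h := hmono (left_mem_Icc.2 hB1) (right_mem_Icc.2 hB1) hB1
  have h2 : v 1 * (B - 1) = -comparisonSol Δ 1 := by
    have : v 1 ≠ 0 := hv1.ne
    rw [hB]; field_simp; ring
  simp only at h
  linarith [hpos B, hpos 1]

lemma firstZero_mem {Δ : ℝ} (hΔ : 0 ≤ Δ) :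
    0 ≤ firstZero Δ ∧ comparisonSol Δ (firstZero Δ) = 0 := by
  have hc : IsClosed {t : ℝ | 0 ≤ t ∧ comparisonSol Δ t = 0} :=
    isClosed_Ici.inter (isClosed_eq (continuous_comparisonSol hΔ) continuous_const)
  exact hc.csInf_mem (exists_comparisonSol_eq_zero hΔ) ⟨0, fun t ht => ht.1⟩

lemma comparisonSol_firstZero {Δ : ℝ} (hΔ : 0 ≤ Δ) : comparisonSol Δ (firstZero Δ) = 0 :=
  (firstZero_mem hΔ).2

lemma firstZero_pos {Δ : ℝ} (hΔ : 0 ≤ Δ) : 0 < firstZero Δ := by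
  refine (firstZero_mem hΔ).1.lt_of_ne fun h => ?_
  have := comparisonSol_firstZero hΔ
  rw [← h, comparisonSol_of_nonpos hΔ le_rfl] at this
  exact one_ne_zero this

lemma comparisonSol_pos {Δ : ℝ} (hΔ : 0 ≤ Δ) {t : ℝ} (ht : t < firstZero Δ) :
    0 < comparisonSol Δ t := by
  rcases le_total t 0 with h | h
  · rw [comparisonSol_of_nonpos hΔ h]; exact one_pos
  · by_contra! hneg
    obtain ⟨u, hu, hu'⟩ := intermediate_value_Icc' h
      (continuous_comparisonSol hΔ).continuousOn
      ⟨hneg, comparisonSol_of_nonpos hΔ (le_refl (0 : ℝ)) ▸ zero_le_one⟩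
    have : firstZero Δ ≤ u := csInf_le ⟨0, fun t ht => ht.1⟩ ⟨hu.1, hu'⟩
    linarith [hu.2]

lemma strictAntiOn_comparisonSol {Δ : ℝ} (hΔ : 0 ≤ Δ) :
    StrictAntiOn (comparisonSol Δ) (Icc 0 (firstZero Δ)) := by
  obtain ⟨v, hr, hv0, hv⟩ := exists_hasDerivAt_comparisonSol hΔ
  have hanti : StrictAntiOn v (Icc 0 (firstZero Δ)) :=
    strictAntiOn_deriv_comparisonSol hΔ hv fun t => comparisonSol_pos hΔ
  refine strictAntiOn_of_deriv_neg (convex_Icc _ _)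
    (continuous_comparisonSol hΔ).continuousOn fun t ht => ?_
  rw [interior_Icc] at ht
  rw [(hr t).deriv, ← hv0 0 le_rfl]
  exact hanti (left_mem_Icc.2 (firstZero_pos hΔ).le) ⟨ht.1.le, ht.2.le⟩ ht.1

lemma antitoneOn_comparisonSol {Δ : ℝ} (hΔ : 0 ≤ Δ) :
    AntitoneOn (comparisonSol Δ) (Iic (firstZero Δ)) := by
  intro s hs t ht hst
  rcases le_total s 0 with h | h
  · rw [comparisonSol_of_nonpos hΔ h]
    rcases le_total t 0 with h' | h'
    · rw [comparisonSol_of_nonpos hΔ h']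
    · rw [← comparisonSol_of_nonpos hΔ (le_refl (0 : ℝ))]
      exact (strictAntiOn_comparisonSol hΔ).antitoneOn
        (left_mem_Icc.2 (firstZero_pos hΔ).le) ⟨h', ht⟩ h'
  · exact (strictAntiOn_comparisonSol hΔ).antitoneOn ⟨h, hs⟩ ⟨h.trans hst, ht⟩ hst

lemma comparisonSol_le_one {Δ : ℝ} (hΔ : 0 ≤ Δ) {t : ℝ} (ht : t ≤ firstZero Δ) :
    comparisonSol Δ t ≤ 1 := by
  rcases le_total t 0 with h | h
  · exact (comparisonSol_of_nonpos hΔ h).le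
  · rw [← comparisonSol_of_nonpos hΔ (le_refl (0 : ℝ))]
    exact antitoneOn_comparisonSol hΔ (firstZero_pos hΔ).le ht h

lemma comparisonSol_lt_one {Δ : ℝ} (hΔ : 0 ≤ Δ) {t : ℝ} (h0 : 0 < t) (ht : t ≤ firstZero Δ) :
    comparisonSol Δ t < 1 := by
  rw [← comparisonSol_of_nonpos hΔ (le_refl (0 : ℝ))]
  exact strictAntiOn_comparisonSol hΔ (left_mem_Icc.2 (firstZero_pos hΔ).le) ⟨h0.le, ht⟩ h0

/-! ### The barriers `β_n` -/

/-- The properties shared by the functions `β_n`. Continuity is asked for on the whole line, so that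
the integrals in the definitions never meet a function that is not integrable. -/
structure IsBarrier (β : ℝ → ℝ) : Prop where
  continuous : Continuous β
  antitoneOn : AntitoneOn β (Iic 0)
  nonneg : ∀ t ≤ 0, 0 ≤ β t
  le_one : ∀ t ≤ 0, β t ≤ 1
  eq_one : ∃ K : ℝ, 0 ≤ K ∧ ∀ t ≤ -K, β t = 1

lemma le_forcing (Δ : ℝ) (β : ℝ → ℝ) (v : ℝ) : β v ≤ forcing 1 Δ β v := le_max_left _ _

lemma comparisonSol_le_forcing {Δ : ℝ} (β : ℝ → ℝ) {v : ℝ} (hv : v ∈ Icc (-Δ) 0) :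
    comparisonSol Δ (firstZero Δ - v - Δ) ≤ forcing 1 Δ β v := by
  have : comparisonSol Δ (firstZero Δ - v - Δ) =
      1 * comparisonSol Δ (firstZero Δ - v - Δ) * indicator (Icc (-Δ) 0) (fun _ => 1) v := by
    rw [indicator_of_mem hv]; ring
  rw [this]
  exact le_max_right _ _

lemma forcing_mono {Δ : ℝ} {β γ : ℝ → ℝ} {v : ℝ} (h : β v ≤ γ v) :
    forcing 1 Δ β v ≤ forcing 1 Δ γ v := max_le_max h le_rfl

lemma IsBarrier.forcing_nonneg {β : ℝ → ℝ} (h : IsBarrier β) (Δ : ℝ) {v : ℝ} (hv : v ≤ 0) :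
    0 ≤ forcing 1 Δ β v := (h.nonneg v hv).trans (le_forcing Δ β v)

lemma IsBarrier.forcing_le_one {β : ℝ → ℝ} (h : IsBarrier β) {Δ : ℝ} (hΔ : 0 ≤ Δ) {v : ℝ}
    (hv : v ≤ 0) : forcing 1 Δ β v ≤ 1 := by
  refine max_le (h.le_one v hv) ?_
  by_cases hv' : v ∈ Icc (-Δ) 0
  · rw [indicator_of_mem hv', one_mul, mul_one]
    exact comparisonSol_le_one hΔ (by linarith [hv'.1])
  · rw [indicator_of_notMem hv', mul_zero]
    exact zero_le_one

lemma IsBarrier.intervalIntegrable_forcing {β : ℝ → ℝ} (h : IsBarrier β) {Δ : ℝ} (hΔ : 0 ≤ Δ)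
    (a b : ℝ) : IntervalIntegrable (forcing 1 Δ β) volume a b := by
  have h1 : IntervalIntegrable β volume a b := h.continuous.intervalIntegrable a b
  have hc : Continuous fun v => 1 * comparisonSol Δ (firstZero Δ - v - Δ) := by
    have := continuous_comparisonSol hΔ
    fun_prop
  have h2 : IntervalIntegrable (fun v => 1 * comparisonSol Δ (firstZero Δ - v - Δ) *
      indicator (Icc (-Δ) 0) (fun _ => (1 : ℝ)) v) volume a b := by
    have : (fun v => 1 * comparisonSol Δ (firstZero Δ - v - Δ) *
      indicator (Icc (-Δ) 0) (fun _ => (1 : ℝ)) v) =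
        indicator (Icc (-Δ) 0) fun v => 1 * comparisonSol Δ (firstZero Δ - v - Δ) := by
      funext v
      by_cases hv : v ∈ Icc (-Δ) 0 <;> simp [hv]
    rw [this]
    have h3 := hc.intervalIntegrable (μ := volume) a b
    exact ⟨h3.1.indicator measurableSet_Icc, h3.2.indicator measurableSet_Icc⟩
  exact ⟨h1.1.sup h2.1, h1.2.sup h2.2⟩

lemma IsBarrier.doubleIntegral_eq {β : ℝ → ℝ} (h : IsBarrier β) {Δ : ℝ} (hΔ : 0 ≤ Δ) (w : ℝ) :
    doubleIntegral 1 Δ β w = ∫ v in w..0, -v * forcing 1 Δ β v := by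
  rw [doubleIntegral, integral_integral_eq (h.intervalIntegrable_forcing hΔ)]
  simp

lemma IsBarrier.intervalIntegrable_mul_forcing {β : ℝ → ℝ} (h : IsBarrier β) {Δ : ℝ}
    (hΔ : 0 ≤ Δ) (a b : ℝ) : IntervalIntegrable (fun v => -v * forcing 1 Δ β v) volume a b :=
  (h.intervalIntegrable_forcing hΔ a b).continuousOn_mul continuous_neg.continuousOn

lemma IsBarrier.continuous_doubleIntegral {β : ℝ → ℝ} (h : IsBarrier β) {Δ : ℝ} (hΔ : 0 ≤ Δ) :
    Continuous fun w => doubleIntegral 1 Δ β (-w) := by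
  have h1 := intervalIntegral.continuous_primitive (h.intervalIntegrable_mul_forcing hΔ) 0
  have h2 : (fun w => doubleIntegral 1 Δ β (-w)) =
      fun w => -∫ v in (0 : ℝ)..(-w), -v * forcing 1 Δ β v := by
    funext w
    rw [h.doubleIntegral_eq hΔ, intervalIntegral.integral_symm]
  rw [h2]
  exact (h1.comp continuous_neg).neg

lemma doubleIntegral_zero (Δ : ℝ) (β : ℝ → ℝ) : doubleIntegral 1 Δ β 0 = 0 := by
  simp [doubleIntegral]

/-- Since `β = 1` far to the left, `∫_{-w}^0 (-v) g v dv` grows beyond all bounds. -/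
lemma IsBarrier.exists_one_le {β : ℝ → ℝ} (h : IsBarrier β) {Δ : ℝ} (hΔ : 0 ≤ Δ) :
    ∃ w, 0 ≤ w ∧ 1 ≤ doubleIntegral 1 Δ β (-w) := by
  obtain ⟨K, hK, hK1⟩ := h.eq_one
  refine ⟨K + 2, by linarith, ?_⟩
  have hi := h.intervalIntegrable_mul_forcing hΔ
  rw [h.doubleIntegral_eq hΔ, ← intervalIntegral.integral_add_adjacent_intervals
    (hi (-(K + 2)) (-K)) (hi (-K) 0)]
  have h1 : 0 ≤ ∫ v in (-K)..0, -v * forcing 1 Δ β v :=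
    intervalIntegral.integral_nonneg (by linarith) fun v hv =>
      mul_nonneg (by linarith [hv.2]) (h.forcing_nonneg Δ hv.2)
  have h2 : ∫ v in (-(K + 2))..(-K), -v ≤ ∫ v in (-(K + 2))..(-K), -v * forcing 1 Δ β v := by
    refine intervalIntegral.integral_mono_on (by linarith)
      (continuous_neg.intervalIntegrable _ _) (hi _ _) fun v hv => ?_
    have := le_forcing Δ β v
    rw [hK1 v hv.2] at this
    have h0 : 0 ≤ -v := by linarith [hv.2]
    nlinarith
  have h3 : ∫ v in (-(K + 2))..(-K), -v = 2 * K + 2 := by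
    rw [intervalIntegral.integral_neg, integral_id]; ring
  linarith

lemma IsBarrier.hitLength_spec {β : ℝ → ℝ} (h : IsBarrier β) {Δ : ℝ} (hΔ : 0 ≤ Δ) :
    0 < hitLength 1 Δ β ∧ doubleIntegral 1 Δ β (-hitLength 1 Δ β) = 1 ∧
      ∀ w, 0 ≤ w → 1 ≤ doubleIntegral 1 Δ β (-w) → hitLength 1 Δ β ≤ w := by
  have hc := h.continuous_doubleIntegral hΔ
  set S := {w : ℝ | 0 < w ∧ doubleIntegral 1 Δ β (-w) = 1} with hS
  have hS' : S = {w : ℝ | 0 ≤ w ∧ doubleIntegral 1 Δ β (-w) = 1} := by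
    ext w
    refine ⟨fun hw => ⟨hw.1.le, hw.2⟩, fun hw => ⟨hw.1.lt_of_ne fun h0 => ?_, hw.2⟩⟩
    have := hw.2
    rw [← h0, neg_zero, doubleIntegral_zero] at this
    exact zero_ne_one this
  have hbdd : BddBelow S := ⟨0, fun w hw => hw.1.le⟩
  have hex : ∀ w, 0 ≤ w → 1 ≤ doubleIntegral 1 Δ β (-w) → ∃ u ∈ S, u ≤ w := fun w hw hw1 => by
    obtain ⟨u, hu, hu'⟩ := intermediate_value_Icc hw hc.continuousOn
      (show (1 : ℝ) ∈ Icc _ _ from ⟨by simp [doubleIntegral_zero], hw1⟩)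
    exact ⟨u, hS' ▸ ⟨hu.1, hu'⟩, hu.2⟩
  have hcl : IsClosed S := by
    rw [hS']
    exact isClosed_Ici.inter (isClosed_eq hc continuous_const)
  have hne : S.Nonempty := by
    obtain ⟨w, hw, hw1⟩ := h.exists_one_le hΔ
    obtain ⟨u, hu, -⟩ := hex w hw hw1
    exact ⟨u, hu⟩
  have hmem : hitLength 1 Δ β ∈ S := hcl.csInf_mem hne hbdd
  refine ⟨hmem.1, hmem.2, fun w hw hw1 => ?_⟩
  obtain ⟨u, hu, huw⟩ := hex w hw hw1
  exact (csInf_le hbdd hu).trans huw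

/-- The step `β_n ↦ β_{n+1}`. -/
noncomputable def nextBarrier (Δ : ℝ) (β : ℝ → ℝ) (t : ℝ) : ℝ :=
  if t ≤ -(hitLength 1 Δ β) then 1
  else 1 - ∫ s in (-(hitLength 1 Δ β))..t, ∫ v in (-(hitLength 1 Δ β))..s, forcing 1 Δ β v

lemma betaSeq_succ (Δ : ℝ) (n : ℕ) : betaSeq 1 Δ (n + 1) = nextBarrier Δ (betaSeq 1 Δ n) := by
  funext t
  rw [betaSeq, nextBarrier]

lemma nextBarrier_of_le {Δ : ℝ} {β : ℝ → ℝ} {t : ℝ} (ht : t ≤ -hitLength 1 Δ β) :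
    nextBarrier Δ β t = 1 := if_pos ht

lemma nextBarrier_of_ge {Δ : ℝ} {β : ℝ → ℝ} {t : ℝ} (ht : -hitLength 1 Δ β ≤ t) :
    nextBarrier Δ β t =
      1 - ∫ s in (-(hitLength 1 Δ β))..t, ∫ v in (-(hitLength 1 Δ β))..s, forcing 1 Δ β v := by
  rcases ht.eq_or_lt with h | h
  · rw [nextBarrier_of_le h.ge, ← h]; simp
  · exact if_neg h.not_ge

lemma IsBarrier.hasDerivWithinAt_nextBarrier {β : ℝ → ℝ} (h : IsBarrier β) {Δ : ℝ}
    (hΔ : 0 ≤ Δ) {e : ℝ} (he : e ≤ hitLength 1 Δ β) {t : ℝ} (ht : t ∈ Icc (-e) 0) :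
    HasDerivWithinAt (nextBarrier Δ β) (-∫ v in (-(hitLength 1 Δ β))..t, forcing 1 Δ β v)
      (Icc (-e) 0) t :=
  ((hasDerivAt_integral_integral
    (h.intervalIntegrable_forcing hΔ) _ t).const_sub 1).hasDerivWithinAt.congr
    (fun y hy => nextBarrier_of_ge (by linarith [hy.1]))
    (nextBarrier_of_ge (by linarith [ht.1]))

lemma IsBarrier.nextBarrier_zero {β : ℝ → ℝ} (h : IsBarrier β) {Δ : ℝ} (hΔ : 0 ≤ Δ) :
    nextBarrier Δ β 0 = 0 := by
  obtain ⟨hpos, heq, -⟩ := h.hitLength_spec hΔ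
  rw [nextBarrier_of_ge (by linarith)]
  rw [doubleIntegral] at heq
  linarith

lemma IsBarrier.next {β : ℝ → ℝ} (h : IsBarrier β) {Δ : ℝ} (hΔ : 0 ≤ Δ) :
    IsBarrier (nextBarrier Δ β) := by
  obtain ⟨hpos, -, -⟩ := h.hitLength_spec hΔ
  set ϖ := hitLength 1 Δ β with hϖ
  have hd : ∀ t ∈ Icc (-ϖ) 0, HasDerivWithinAt (nextBarrier Δ β)
      (-∫ v in (-ϖ)..t, forcing 1 Δ β v) (Icc (-ϖ) 0) t := fun t ht =>
    h.hasDerivWithinAt_nextBarrier hΔ le_rfl ht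
  have hm : AntitoneOn (nextBarrier Δ β) (Icc (-ϖ) 0) := by
    have := monotoneOn_Icc_of_hasDerivWithinAt (fun t ht => (hd t ht).neg) fun t ht => by
      rw [neg_neg]
      exact intervalIntegral.integral_nonneg ht.1 fun v hv =>
        h.forcing_nonneg Δ (hv.2.trans ht.2)
    simpa using! this.neg
  have hm' : AntitoneOn (nextBarrier Δ β) (Iic 0) := by
    intro a ha b hb hab
    rcases le_total a (-ϖ) with h1 | h1
    · rw [nextBarrier_of_le (h1.trans_eq (by rw [hϖ]))]
      rcases le_total b (-ϖ) with h2 | h2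
      · rw [nextBarrier_of_le h2]
      · rw [← nextBarrier_of_le (le_refl (-ϖ))]
        exact hm (left_mem_Icc.2 (by linarith)) ⟨h2, hb⟩ h2
    · exact hm ⟨h1, ha⟩ ⟨h1.trans hab, hb⟩ hab
  refine ⟨?_, hm', fun t ht => ?_, fun t ht => ?_, ϖ, hpos.le, fun t ht => nextBarrier_of_le ht⟩
  · refine Continuous.if_le continuous_const ?_ continuous_id continuous_const fun t ht => ?_
    · exact continuous_iff_continuousAt.2 fun t => ((hasDerivAt_integral_integral
        (h.intervalIntegrable_forcing hΔ) _ t).const_sub 1).continuousAt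
    · rw [show t = -hitLength 1 Δ β from ht]; simp
  · rw [← h.nextBarrier_zero hΔ]
    exact hm' ht self_mem_Iic ht
  · rcases le_total t (-ϖ) with h1 | h1
    · exact (nextBarrier_of_le h1).le
    · rw [← nextBarrier_of_le (le_refl (-ϖ))]
      exact hm' (show -ϖ ≤ 0 by linarith) ht h1

lemma isBarrier_betaSeq {Δ : ℝ} (hΔ : 0 ≤ Δ) (n : ℕ) : IsBarrier (betaSeq 1 Δ n) := by
  induction n with
  | zero =>
    exact ⟨continuous_const, fun _ _ _ _ _ => le_rfl, fun _ _ => zero_le_one,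
      fun _ _ => le_rfl, 0, le_rfl, fun _ _ => rfl⟩
  | succ n ih => rw [betaSeq_succ]; exact ih.next hΔ

/-- The comparison principle for the barriers. If `Y'' ≥ -g` on `[-e, 0]`, where `g` is the forcing
built from `β`, then `Y - β_next` is convex there, and so the boundary conditions make it
nonpositive. -/
lemma IsBarrier.le_nextBarrier {β : ℝ → ℝ} (h : IsBarrier β) {Δ : ℝ} (hΔ : 0 ≤ Δ) {e : ℝ}
    (he0 : 0 ≤ e) (he : e ≤ hitLength 1 Δ β) {Y Y' : ℝ → ℝ}
    (hY : ∀ t ∈ Icc (-e) 0, HasDerivWithinAt Y (Y' t) (Icc (-e) 0) t)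
    (hY' : ∀ t ∈ Icc (-e) 0, ∀ u ∈ Icc (-e) 0, t ≤ u →
      -∫ v in t..u, forcing 1 Δ β v ≤ Y' u - Y' t)
    (h0 : Y 0 ≤ 0) (hleft : 0 ≤ Y' (-e) ∨ e = hitLength 1 Δ β ∧ Y (-e) ≤ 1)
    {t : ℝ} (ht : t ∈ Icc (-e) 0) : Y t ≤ nextBarrier Δ β t := by
  have hm0 : (0 : ℝ) ∈ Icc (-e) 0 := right_mem_Icc.2 (by linarith)
  have hme : -e ∈ Icc (-e) 0 := left_mem_Icc.2 (by linarith)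
  have hd : ∀ t ∈ Icc (-e) 0, HasDerivWithinAt (fun t => Y t - nextBarrier Δ β t)
      (Y' t - -∫ v in (-(hitLength 1 Δ β))..t, forcing 1 Δ β v) (Icc (-e) 0) t := fun t ht =>
    (hY t ht).sub (h.hasDerivWithinAt_nextBarrier hΔ he ht)
  have hmono : MonotoneOn
      (fun t => Y' t - -∫ v in (-(hitLength 1 Δ β))..t, forcing 1 Δ β v) (Icc (-e) 0) := by
    intro t ht u hu htu
    have hi := h.intervalIntegrable_forcing hΔ
    have := intervalIntegral.integral_add_adjacent_intervals
      (hi (-(hitLength 1 Δ β)) t) (hi t u)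
    simp only
    linarith [hY' t ht u hu htu]
  have hz0 : Y 0 - nextBarrier Δ β 0 ≤ 0 := by rw [h.nextBarrier_zero hΔ]; linarith
  rcases hleft with hl | ⟨rfl, hl⟩
  · have hl' : 0 ≤ Y' (-e) - -∫ v in (-(hitLength 1 Δ β))..(-e), forcing 1 Δ β v := by
      have : 0 ≤ ∫ v in (-(hitLength 1 Δ β))..(-e), forcing 1 Δ β v :=
        intervalIntegral.integral_nonneg (by linarith) fun v hv =>
          h.forcing_nonneg Δ (by linarith [hv.2])
      linarith
    have := monotoneOn_Icc_of_hasDerivWithinAt hd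
      (fun t ht => hl'.trans (hmono hme ht ht.1)) ht hm0 ht.2
    simp only at this
    linarith
  · have := (convexOn_Icc_of_hasDerivWithinAt hd hmono).le_max_of_mem_Icc hme hm0 ht
    rw [nextBarrier_of_le le_rfl] at this
    have h2 := max_le (show Y (-hitLength 1 Δ β) - 1 ≤ 0 by linarith) hz0
    linarith

/-! ### Convergence of the hitting lengths -/

lemma varpi_pos {Δ : ℝ} (hΔ : 0 ≤ Δ) (n : ℕ) : 0 < varpi 1 Δ n :=
  ((isBarrier_betaSeq hΔ n).hitLength_spec hΔ).1

lemma varpi_le_of_one_le {Δ : ℝ} (hΔ : 0 ≤ Δ) (n : ℕ) {w : ℝ} (hw : 0 ≤ w)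
    (h : 1 ≤ doubleIntegral 1 Δ (betaSeq 1 Δ n) (-w)) : varpi 1 Δ n ≤ w :=
  ((isBarrier_betaSeq hΔ n).hitLength_spec hΔ).2.2 w hw h

lemma IsBarrier.hitLength_le_of_le {β γ : ℝ → ℝ} (hβ : IsBarrier β) (hγ : IsBarrier γ) {Δ : ℝ}
    (hΔ : 0 ≤ Δ) (h : ∀ t ≤ 0, γ t ≤ β t) : hitLength 1 Δ β ≤ hitLength 1 Δ γ := by
  obtain ⟨hpos, heq, -⟩ := hγ.hitLength_spec hΔ
  refine (hβ.hitLength_spec hΔ).2.2 _ hpos.le ?_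
  refine heq.ge.trans ?_
  rw [hβ.doubleIntegral_eq hΔ, hγ.doubleIntegral_eq hΔ]
  refine intervalIntegral.integral_mono_on (by linarith)
    (hγ.intervalIntegrable_mul_forcing hΔ _ _) (hβ.intervalIntegrable_mul_forcing hΔ _ _)
    fun v hv => ?_
  exact mul_le_mul_of_nonneg_left (forcing_mono (h v hv.2)) (by linarith [hv.2])

lemma betaSeq_succ_le {Δ : ℝ} (hΔ : 0 ≤ Δ) (n : ℕ) :
    ∀ t ≤ 0, betaSeq 1 Δ (n + 1) t ≤ betaSeq 1 Δ n t := by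
  induction n with
  | zero => exact (isBarrier_betaSeq hΔ 1).le_one
  | succ n ih =>
    intro t ht
    have hn := isBarrier_betaSeq hΔ n
    have hn1 := isBarrier_betaSeq hΔ (n + 1)
    have hn2 := isBarrier_betaSeq hΔ (n + 2)
    have hle : hitLength 1 Δ (betaSeq 1 Δ n) ≤ hitLength 1 Δ (betaSeq 1 Δ (n + 1)) :=
      hn.hitLength_le_of_le hn1 hΔ ih
    have hpos : 0 < hitLength 1 Δ (betaSeq 1 Δ n) := varpi_pos hΔ n
    rcases le_total t (-hitLength 1 Δ (betaSeq 1 Δ n)) with h | h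
    · rw [betaSeq_succ Δ n, nextBarrier_of_le h]
      exact hn2.le_one t ht
    · rw [betaSeq_succ Δ n]
      refine hn.le_nextBarrier hΔ hpos.le le_rfl (Y := betaSeq 1 Δ (n + 2))
        (Y' := fun t => -∫ v in (-(hitLength 1 Δ (betaSeq 1 Δ (n + 1))))..t,
          forcing 1 Δ (betaSeq 1 Δ (n + 1)) v)
        (fun t ht => ?_) (fun t ht u hu htu => ?_) ?_ (.inr ⟨rfl, ?_⟩) ⟨h, ht⟩
      · rw [betaSeq_succ Δ (n + 1)]
        exact hn1.hasDerivWithinAt_nextBarrier hΔ hle ht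
      · have hi := hn1.intervalIntegrable_forcing hΔ
        have h1 := intervalIntegral.integral_add_adjacent_intervals
          (hi (-(hitLength 1 Δ (betaSeq 1 Δ (n + 1)))) t) (hi t u)
        have h2 : ∫ v in t..u, forcing 1 Δ (betaSeq 1 Δ (n + 1)) v ≤
            ∫ v in t..u, forcing 1 Δ (betaSeq 1 Δ n) v :=
          intervalIntegral.integral_mono_on htu (hi t u) (hn.intervalIntegrable_forcing hΔ t u)
            fun v hv => forcing_mono (ih v (hv.2.trans hu.2))
        linarith
      · rw [betaSeq_succ Δ (n + 1), hn1.nextBarrier_zero hΔ]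
      · exact hn2.le_one _ (neg_nonpos.2 hpos.le)

lemma monotone_varpi {Δ : ℝ} (hΔ : 0 ≤ Δ) : Monotone (varpi 1 Δ) :=
  monotone_nat_of_le_succ fun n => (isBarrier_betaSeq hΔ n).hitLength_le_of_le
    (isBarrier_betaSeq hΔ (n + 1)) hΔ (betaSeq_succ_le hΔ n)

lemma integral_mul_sin : ∫ v in (-(Real.pi / 2))..0, -v * -Real.sin v = 1 := by
  have h : ∀ v ∈ uIcc (-(Real.pi / 2)) 0,
      HasDerivAt (fun v => Real.sin v - v * Real.cos v) (-v * -Real.sin v) v := fun v _ => by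
    convert! (Real.hasDerivAt_sin v).sub ((hasDerivAt_id v).mul (Real.hasDerivAt_cos v)) using 1
    simp
  rw [intervalIntegral.integral_eq_sub_of_hasDerivAt h
    ((by fun_prop : Continuous fun v : ℝ => -v * -Real.sin v).intervalIntegrable _ _)]
  simp

lemma IsBarrier.hitLength_le_pi_div_two {β : ℝ → ℝ} (h : IsBarrier β) {Δ : ℝ} (hΔ : 0 ≤ Δ)
    (hsin : ∀ t ∈ Icc (-(Real.pi / 2)) 0, -Real.sin t ≤ β t) :
    hitLength 1 Δ β ≤ Real.pi / 2 := by
  refine (h.hitLength_spec hΔ).2.2 _ (by positivity) (integral_mul_sin.ge.trans ?_)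
  rw [h.doubleIntegral_eq hΔ]
  refine intervalIntegral.integral_mono_on (by linarith [Real.pi_pos])
    ((by fun_prop : Continuous fun v : ℝ => -v * -Real.sin v).intervalIntegrable _ _)
    (h.intervalIntegrable_mul_forcing hΔ _ _) fun v hv => ?_
  exact mul_le_mul_of_nonneg_left ((hsin v hv).trans (le_forcing Δ _ v)) (by linarith [hv.2])

/-- All barriers lie above `-sin`, the fixed point of the step without delay. -/
lemma neg_sin_le_betaSeq {Δ : ℝ} (hΔ : 0 ≤ Δ) (n : ℕ) :
    ∀ t ∈ Icc (-(Real.pi / 2)) 0, -Real.sin t ≤ betaSeq 1 Δ n t := by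
  induction n with
  | zero =>
    intro t _
    change -Real.sin t ≤ 1
    linarith [Real.neg_one_le_sin t]
  | succ n ih =>
    intro t ht
    have hn := isBarrier_betaSeq hΔ n
    rw [betaSeq_succ]
    rcases le_total t (-hitLength 1 Δ (betaSeq 1 Δ n)) with h | h
    · rw [nextBarrier_of_le h]
      linarith [Real.neg_one_le_sin t]
    · have hpos : 0 < hitLength 1 Δ (betaSeq 1 Δ n) := varpi_pos hΔ n
      have hle := hn.hitLength_le_pi_div_two hΔ ih
      refine hn.le_nextBarrier hΔ hpos.le le_rfl (Y := fun t => -Real.sin t)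
        (Y' := fun t => -Real.cos t) (fun t ht => (Real.hasDerivAt_sin t).neg.hasDerivWithinAt)
        (fun t ht u hu htu => ?_) (by simp) (.inr ⟨rfl, ?_⟩) ⟨h, ht.2⟩
      · have h1 : ∫ v in t..u, -Real.sin v ≤ ∫ v in t..u, forcing 1 Δ (betaSeq 1 Δ n) v :=
          intervalIntegral.integral_mono_on htu
            (Real.continuous_sin.neg.intervalIntegrable _ _)
            (hn.intervalIntegrable_forcing hΔ t u) fun v hv =>
              (ih v ⟨by linarith [hv.1, ht.1], hv.2.trans hu.2⟩).trans (le_forcing Δ _ v)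
        rw [intervalIntegral.integral_neg, integral_sin] at h1
        linarith
      · linarith [Real.neg_one_le_sin (-hitLength 1 Δ (betaSeq 1 Δ n))]

lemma varpi_le {Δ : ℝ} (hΔ : 0 ≤ Δ) (n : ℕ) : varpi 1 Δ n ≤ Real.pi / 2 :=
  (isBarrier_betaSeq hΔ n).hitLength_le_pi_div_two hΔ (neg_sin_le_betaSeq hΔ n)

lemma tendsto_varpi {Δ : ℝ} (hΔ : 0 ≤ Δ) : Tendsto (varpi 1 Δ) atTop (𝓝 (Psi 1 Δ)) :=
  tendsto_nhds_limUnder ⟨_, tendsto_atTop_ciSup (monotone_varpi hΔ)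
    ⟨Real.pi / 2, by rintro _ ⟨n, rfl⟩; exact varpi_le hΔ n⟩⟩

/-! ### The delay inequality -/

/-- `x : [T, ∞) → ℝ`, with derivative `x'`, satisfies `|x'' t| ≤ |x θ|` for almost every
`t ≥ T + Δ` and some `θ ∈ [t - Δ, t]` depending on `t`. Both `x` and `x'` are locally absolutely
continuous. -/
structure DelayIneq (Δ T : ℝ) (x x' : ℝ → ℝ) : Prop where
  hasDerivWithinAt : ∀ t ≥ T, HasDerivWithinAt x (x' t) (Ici T) t
  ac : ∀ b ≥ T, AbsolutelyContinuousOnInterval x T b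
  ac' : ∀ b ≥ T, AbsolutelyContinuousOnInterval x' T b
  ineq : ∀ᵐ t : ℝ, T + Δ ≤ t → ∃ θ ∈ Icc (t - Δ) t, |deriv x' t| ≤ |x θ|

variable {Δ T : ℝ} {x x' : ℝ → ℝ}

lemma DelayIneq.const_mul (h : DelayIneq Δ T x x') (c : ℝ) :
    DelayIneq Δ T (fun t => c * x t) (fun t => c * x' t) where
  hasDerivWithinAt t ht := (h.hasDerivWithinAt t ht).const_mul c
  ac b hb := (h.ac b hb).const_mul c
  ac' b hb := (h.ac' b hb).const_mul c
  ineq := by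
    filter_upwards [h.ineq] with t ht htT
    obtain ⟨θ, hθ, hle⟩ := ht htT
    refine ⟨θ, hθ, ?_⟩
    rw [deriv_const_mul_field, abs_mul, abs_mul]
    exact mul_le_mul_of_nonneg_left hle (abs_nonneg c)

lemma DelayIneq.mono (h : DelayIneq Δ T x x') {T' : ℝ} (hT : T ≤ T') : DelayIneq Δ T' x x' where
  hasDerivWithinAt t ht := (h.hasDerivWithinAt t (hT.trans ht)).mono (Ici_subset_Ici.2 hT)
  ac b hb := (h.ac b (hT.trans hb)).mono <| by
    rw [uIcc_of_le hb, uIcc_of_le (hT.trans hb)]; exact Icc_subset_Icc_left hT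
  ac' b hb := (h.ac' b (hT.trans hb)).mono <| by
    rw [uIcc_of_le hb, uIcc_of_le (hT.trans hb)]; exact Icc_subset_Icc_left hT
  ineq := by filter_upwards [h.ineq] with t ht htT using ht (by linarith)

lemma DelayIneq.hasDerivAt (h : DelayIneq Δ T x x') {t : ℝ} (ht : T < t) :
    HasDerivAt x (x' t) t := (h.hasDerivWithinAt t ht.le).hasDerivAt (Ici_mem_nhds ht)

lemma DelayIneq.continuousOn (h : DelayIneq Δ T x x') : ContinuousOn x (Ici T) :=
  fun t ht => (h.hasDerivWithinAt t ht).continuousWithinAt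

lemma DelayIneq.abs_deriv_sub_le (h : DelayIneq Δ T x x') {φ : ℝ → ℝ} {t₁ t₂ : ℝ} (hΔ : 0 ≤ Δ)
    (h1 : T + Δ ≤ t₁) (h12 : t₁ ≤ t₂) (hφ : IntervalIntegrable φ volume t₁ t₂)
    (hle : ∀ t ∈ Icc t₁ t₂, ∀ θ ∈ Icc (t - Δ) t, |x θ| ≤ φ t) :
    |x' t₂ - x' t₁| ≤ ∫ t in t₁..t₂, φ t := by
  have hac : AbsolutelyContinuousOnInterval x' t₁ t₂ :=
    (h.ac' t₂ (by linarith)).mono <| by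
      rw [uIcc_of_le h12, uIcc_of_le (by linarith)]; exact Icc_subset_Icc_left (by linarith)
  rw [← hac.integral_deriv_eq_sub, ← Real.norm_eq_abs]
  refine intervalIntegral.norm_integral_le_of_norm_le h12 ?_ hφ
  filter_upwards [h.ineq] with t ht htI
  obtain ⟨θ, hθ, hle'⟩ := ht (by linarith [htI.1])
  exact hle'.trans (hle t ⟨htI.1.le, htI.2⟩ θ hθ)

/-! ### The decay towards a zero -/

/-- A solution bounded by `1` vanishes at `a` only if it lies below the comparison solution with
its first zero at `a`. Otherwise, translate the comparison solution to the right as far as some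
point of its falling part still lies below the graph of `|x|`. At such a point of contact the two
graphs are tangent, and `x` falls no faster than the translate from there on, so that it does not
reach zero at `a`. -/
lemma DelayIneq.abs_le_comparisonSol (h : DelayIneq Δ T x x') (hΔ : 0 ≤ Δ) {a : ℝ}
    (ha : T + Δ + firstZero Δ ≤ a) (hx : ∀ t ∈ Icc T a, |x t| ≤ 1) (hxa : x a = 0) :
    ∀ t ∈ Icc T a, |x t| ≤ comparisonSol Δ (firstZero Δ - (a - t)) := by
  have hr := continuous_comparisonSol hΔ
  have hϑ := firstZero_pos hΔ
  set r := comparisonSol Δ with hr_def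
  set ϑ := firstZero Δ with hϑ_def
  have hxc : ContinuousOn (fun t => |x t|) (Icc T a) :=
    (h.continuousOn.mono Icc_subset_Ici_self).abs
  by_contra! hcon
  obtain ⟨t₁, ht₁, hlt₁⟩ := hcon
  -- pairs of a shift `σ` and a point `t` of the falling part where `|x|` is above the translate
  set S : Set (ℝ × ℝ) := {z | z ∈ Icc 0 ϑ ×ˢ Icc T a ∧ a - ϑ + z.1 ≤ z.2 ∧
    r (ϑ - (a - z.2) - z.1) ≤ |x z.2|} with hS
  have hgrow : ∀ σ, 0 ≤ σ → ∀ t ∈ Icc T a, r (ϑ - (a - t) - σ) < |x t| →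
      ∃ z ∈ S, σ < z.1 := by
    intro σ hσ t ht hlt
    have hpos : 0 < ϑ - (a - t) - σ := by
      by_contra! hneg
      rw [hr_def, comparisonSol_of_nonpos hΔ hneg] at hlt
      linarith [hx t ht]
    have hc : ContinuousAt (fun u => r (ϑ - (a - t) - u)) σ := by fun_prop
    have hev := (hc.eventually (gt_mem_nhds hlt)).and
      (gt_mem_nhds (show σ < ϑ - (a - t) by linarith))
    obtain ⟨u, ⟨hu1, hu2⟩, hu3⟩ := (hev.filter_mono nhdsWithin_le_nhds).and
      (self_mem_nhdsWithin (s := Ioi σ)) |>.exists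
    have hu3 : σ < u := hu3
    exact ⟨(u, t), ⟨⟨⟨by linarith, by linarith [ht.2]⟩, ht⟩, by simp only; linarith, hu1.le⟩, hu3⟩
  have hScl : IsCompact S := by
    have hK : IsCompact (Icc 0 ϑ ×ˢ Icc T a) := isCompact_Icc.prod isCompact_Icc
    have hSeq : S = (Icc 0 ϑ ×ˢ Icc T a) ∩ ({z : ℝ × ℝ | a - ϑ + z.1 ≤ z.2} ∩
        {z | z ∈ Icc 0 ϑ ×ˢ Icc T a ∧ r (ϑ - (a - z.2) - z.1) ≤ |x z.2|}) := by
      ext z; simp only [hS, mem_ofPred_eq, mem_inter_iff]; tauto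
    have hcl : IsClosed {z : ℝ × ℝ | z ∈ Icc 0 ϑ ×ˢ Icc T a ∧
        r (ϑ - (a - z.2) - z.1) ≤ |x z.2|} := by
      refine hK.isClosed.isClosed_le ?_ ?_
      · exact (by fun_prop : Continuous fun z : ℝ × ℝ => r (ϑ - (a - z.2) - z.1)).continuousOn
      · exact hxc.comp continuous_snd.continuousOn fun z hz => hz.2
    rw [hSeq]
    exact hK.inter_right
      ((isClosed_le (by fun_prop) (by fun_prop)).inter hcl)
  obtain ⟨z₁, hz₁, hz₁pos⟩ := hgrow 0 le_rfl t₁ ht₁ (by simpa using hlt₁)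
  obtain ⟨⟨σ, t₀⟩, hz, hmax⟩ := hScl.exists_isMaxOn ⟨z₁, hz₁⟩ continuous_fst.continuousOn
  obtain ⟨⟨hσ, ht₀⟩, hst, hcontact⟩ := hz
  simp only at hσ ht₀ hst hcontact
  have hσpos : 0 < σ := hz₁pos.trans_le (hmax hz₁)
  have hbelow : ∀ t ∈ Icc T a, |x t| ≤ r (ϑ - (a - t) - σ) := by
    by_contra! hc
    obtain ⟨t, ht, hlt⟩ := hc
    obtain ⟨z, hz, hlt'⟩ := hgrow σ hσpos.le t ht hlt
    exact absurd (hmax hz) (not_le.2 hlt')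
  have heq : |x t₀| = r (ϑ - (a - t₀) - σ) := le_antisymm (hbelow t₀ ht₀) hcontact
  have hra : 0 < r (ϑ - (a - a) - σ) := comparisonSol_pos hΔ (by linarith)
  have ht₀a : t₀ < a := by
    refine ht₀.2.lt_of_ne fun he => ?_
    rw [he, hxa, abs_zero] at heq
    linarith
  have hTt₀ : T + Δ < t₀ := by linarith
  -- replacing `x` by `-x`, the contact is with the graph of `x` itself
  obtain ⟨c, hc, hcx⟩ : ∃ c : ℝ, |c| = 1 ∧ c * x t₀ = |x t₀| := by
    rcases le_total 0 (x t₀) with hs | hs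
    · exact ⟨1, by simp, by rw [abs_of_nonneg hs, one_mul]⟩
    · exact ⟨-1, by simp, by rw [abs_of_nonpos hs]; ring⟩
  have hy := h.const_mul c
  have hyabs : ∀ t, |c * x t| = |x t| := fun t => by rw [abs_mul, hc, one_mul]
  obtain ⟨v, hv, hv0, hv'⟩ := exists_hasDerivAt_comparisonSol hΔ
  have hrd : ∀ t, HasDerivAt (fun t => r (ϑ - (a - t) - σ)) (v (ϑ - (a - t) - σ)) t := fun t => by
    have h1 : HasDerivAt (fun t : ℝ => ϑ - (a - t) - σ) 1 t := by
      simpa using (((hasDerivAt_id t).const_sub a).const_sub ϑ).sub_const σ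
    simpa using! (hv (ϑ - (a - t) - σ)).comp t h1
  have hfd : ∀ t, T < t → HasDerivAt (fun t => r (ϑ - (a - t) - σ) - c * x t)
      (v (ϑ - (a - t) - σ) - c * x' t) t := fun t ht => (hrd t).sub (hy.hasDerivAt ht)
  have htan : v (ϑ - (a - t₀) - σ) - c * x' t₀ = 0 := by
    refine IsLocalMin.hasDerivAt_eq_zero ?_ (hfd t₀ (by linarith))
    filter_upwards [Icc_mem_nhds (show T < t₀ by linarith) ht₀a] with t ht
    have := hbelow t ht
    rw [hcx, heq, sub_self, sub_nonneg]
    exact (le_abs_self _).trans ((hyabs t).trans_le this)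
  have hmono : MonotoneOn (fun t => -(r (ϑ - (a - t) - σ) - c * x t)) (Icc t₀ a) := by
    refine monotoneOn_Icc_of_hasDerivWithinAt
      (fun t ht => (hfd t (by linarith [ht.1])).neg.hasDerivWithinAt) fun t ht => ?_
    have hrc : Continuous fun u => r (ϑ - (a - u) - σ - Δ) := by fun_prop
    have h1 := hy.abs_deriv_sub_le hΔ hTt₀.le ht.1 (hrc.intervalIntegrable t₀ t)
      fun u hu θ hθ => by
        rw [hyabs]
        refine (hbelow θ ⟨by linarith [hu.1, hθ.1], hθ.2.trans (hu.2.trans ht.2)⟩).trans ?_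
        exact antitoneOn_comparisonSol hΔ
          (show _ ≤ ϑ by linarith [hu.2, ht.2]) (show _ ≤ ϑ by linarith [hu.2, ht.2, hθ.2])
          (by linarith [hθ.1])
    have h2 : v (ϑ - (a - t) - σ) - v (ϑ - (a - t₀) - σ) =
        -∫ u in t₀..t, r (ϑ - (a - u) - σ - Δ) := by
      rw [← intervalIntegral.integral_neg]
      symm
      have hd : ∀ u ∈ Icc t₀ t, HasDerivWithinAt (fun u => v (ϑ - (a - u) - σ))
          (-r (ϑ - (a - u) - σ - Δ)) (Ici t₀) u := fun u hu => by
        have h1 : HasDerivWithinAt (fun u : ℝ => ϑ - (a - u) - σ) 1 (Ici t₀) u := by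
          simpa using ((((hasDerivAt_id u).const_sub a).const_sub ϑ).sub_const σ).hasDerivWithinAt
        have := (hv' (ϑ - (a - u) - σ) (by linarith [hu.1])).comp u h1
          fun w hw => show (0 : ℝ) ≤ _ by linarith [show t₀ ≤ w from hw]
        simpa using! this
      refine intervalIntegral.integral_eq_sub_of_hasDeriv_right_of_le ht.1
        (fun u hu => (hd u hu).continuousWithinAt.mono Icc_subset_Ici_self)
        (fun u hu => (hd u ⟨hu.1.le, hu.2.le⟩).mono fun w hw =>
          hu.1.le.trans (show u < w from hw).le) (hrc.neg.intervalIntegrable _ _)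
    have h3 := (abs_le.1 h1).1
    linarith
  have h4 := hmono (left_mem_Icc.2 ht₀a.le) (right_mem_Icc.2 ht₀a.le) ht₀a.le
  simp only at h4
  rw [hcx, heq, hxa] at h4
  linarith

lemma DelayIneq.abs_le_mul_comparisonSol (h : DelayIneq Δ T x x') (hΔ : 0 ≤ Δ) {a M : ℝ}
    (hM : 0 < M) (ha : T + Δ + firstZero Δ ≤ a) (hx : ∀ t ∈ Icc T a, |x t| ≤ M)
    (hxa : x a = 0) {t : ℝ} (ht : t ∈ Icc T a) :
    |x t| ≤ M * comparisonSol Δ (firstZero Δ - (a - t)) := by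
  have hy : ∀ t, |M⁻¹ * x t| = M⁻¹ * |x t| := fun t => by
    rw [abs_mul, abs_of_pos (inv_pos.2 hM)]
  have := (h.const_mul M⁻¹).abs_le_comparisonSol hΔ ha (fun t ht => by
    rw [hy, inv_mul_le_iff₀ hM, mul_one]; exact hx t ht) (by rw [hxa, mul_zero]) t ht
  rwa [hy, inv_mul_le_iff₀ hM] at this

/-! ### The growth away from a zero -/

/-- The double integral of any bound for the right-hand side limits the growth of `x` between a zero
`a` and a critical point `ξ`. -/
lemma DelayIneq.le_integral (h : DelayIneq Δ T x x') (hΔ : 0 ≤ Δ) {a ξ : ℝ} (ha : T + Δ ≤ a)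
    (hTa : T < a) (haξ : a ≤ ξ) (hxa : x a = 0) (hξ : x' ξ = 0) {ψ : ℝ → ℝ}
    (hψ : ∀ a b, IntervalIntegrable ψ volume a b)
    (hle : ∀ t ∈ Icc a ξ, ∀ θ ∈ Icc (t - Δ) t, |x θ| ≤ ψ (a - t)) :
    x ξ ≤ ∫ v in (-(ξ - a))..0, -v * ψ v := by
  have hd : ∀ v ∈ Icc (-(ξ - a)) 0,
      HasDerivWithinAt (fun v => x (a - v) + ∫ s in (-(ξ - a))..v, ∫ w in (-(ξ - a))..s, ψ w)
        (-x' (a - v) + ∫ w in (-(ξ - a))..v, ψ w) (Icc (-(ξ - a)) 0) v := fun v hv => by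
    have h1 := (h.hasDerivAt (show T < a - v by linarith [hv.2])).comp_const_sub a v
    exact (h1.add (hasDerivAt_integral_integral hψ _ v)).hasDerivWithinAt
  have hmono := monotoneOn_Icc_of_hasDerivWithinAt hd fun v hv => by
    have h1 := h.abs_deriv_sub_le hΔ (t₁ := a - v) (t₂ := ξ) (φ := fun t => ψ (a - t))
      (by linarith [hv.2]) (by linarith [hv.1])
      (by simpa using (hψ (a - (a - v)) (a - ξ)).comp_sub_left a)
      fun t ht θ hθ => hle t ⟨by linarith [ht.1, hv.2], ht.2⟩ θ hθ
    rw [intervalIntegral.integral_comp_sub_left (fun v => ψ v) a, hξ,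
      show a - ξ = -(ξ - a) by ring, show a - (a - v) = v by ring] at h1
    linarith [(abs_le.1 h1).1]
  have h2 := hmono (left_mem_Icc.2 (by linarith)) (right_mem_Icc.2 (by linarith))
    (by linarith : -(ξ - a) ≤ 0)
  simp only [sub_neg_eq_add, add_sub_cancel, intervalIntegral.integral_same, add_zero, sub_zero,
    hxa, zero_add] at h2
  rw [integral_integral_eq hψ] at h2
  simpa using h2

/-- While `x` rises from its zero `a`, the values that the delay can reach are either values between
`a` and `t`, where the barrier `β` applies, or values before `a`, where the decay towards the zero
is controlled by the comparison solution: the forcing is the maximum of the two bounds. -/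
lemma DelayIneq.abs_le_forcing (h : DelayIneq Δ T x x') (hΔ : 0 ≤ Δ) {a ξ : ℝ}
    (ha : T + Δ + firstZero Δ ≤ a) (hx : ∀ t ∈ Icc T ξ, |x t| ≤ 1) (hxa : x a = 0)
    (hpos : ∀ t ∈ Icc a ξ, 0 ≤ x t) {β : ℝ → ℝ} (hβ : IsBarrier β)
    (hle : ∀ t ∈ Icc a ξ, x t ≤ β (a - t)) {t : ℝ} (ht : t ∈ Icc a ξ) {θ : ℝ}
    (hθ : θ ∈ Icc (t - Δ) t) : |x θ| ≤ forcing 1 Δ β (a - t) := by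
  have hϑ := firstZero_pos hΔ
  rcases le_or_gt a θ with h1 | h1
  · have hθI : θ ∈ Icc a ξ := ⟨h1, hθ.2.trans ht.2⟩
    rw [abs_of_nonneg (hpos θ hθI)]
    refine (hle θ hθI).trans ((hβ.antitoneOn ?_ ?_ ?_).trans (le_forcing Δ β _))
    · exact sub_nonpos.2 ht.1
    · exact sub_nonpos.2 h1
    · linarith [hθ.2]
  · refine (h.abs_le_comparisonSol hΔ ha (fun u hu => hx u ⟨hu.1, hu.2.trans (ht.1.trans ht.2)⟩)
      hxa θ ⟨by linarith [hθ.1, ht.1], h1.le⟩).trans (le_trans ?_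
        (comparisonSol_le_forcing β ⟨by linarith [hθ.1], by linarith [ht.1]⟩))
    refine antitoneOn_comparisonSol hΔ ?_ ?_ ?_
    · exact mem_Iic.2 (by linarith [hθ.1])
    · exact mem_Iic.2 (by linarith)
    · linarith [hθ.1]

/-- Between a zero and the next critical point, a solution bounded by `1` lies below all the
barriers. -/
lemma DelayIneq.le_betaSeq (h : DelayIneq Δ T x x') (hΔ : 0 ≤ Δ) {a ξ : ℝ}
    (ha : T + Δ + firstZero Δ ≤ a) (haξ : a ≤ ξ) (hx : ∀ t ∈ Icc T ξ, |x t| ≤ 1) (hxa : x a = 0)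
    (hpos : ∀ t ∈ Icc a ξ, 0 ≤ x t) (hξ : x' ξ = 0) (n : ℕ) :
    ∀ t ∈ Icc a ξ, x t ≤ betaSeq 1 Δ n (a - t) := by
  have hϑ := firstZero_pos hΔ
  have hx1 : ∀ t ∈ Icc a ξ, x t ≤ 1 := fun t ht =>
    (le_abs_self _).trans (hx t ⟨by linarith [ht.1], ht.2⟩)
  induction n with
  | zero => exact hx1
  | succ n ih =>
    intro t ht
    have hβ := isBarrier_betaSeq hΔ n
    have hw : 0 < hitLength 1 Δ (betaSeq 1 Δ n) := varpi_pos hΔ n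
    rw [betaSeq_succ]
    rcases le_total (a - t) (-hitLength 1 Δ (betaSeq 1 Δ n)) with h1 | h1
    · rw [nextBarrier_of_le h1]; exact hx1 t ht
    set e := min (ξ - a) (hitLength 1 Δ (betaSeq 1 Δ n)) with he
    have he1 : e ≤ ξ - a := min_le_left _ _
    have key := hβ.le_nextBarrier hΔ (e := e) (le_min (by linarith) hw.le) (min_le_right _ _)
      (Y := fun v => x (a - v)) (Y' := fun v => -x' (a - v)) (t := a - t)
    rw [sub_sub_cancel] at key
    refine key (fun v hv => ?_) (fun v hv u hu hvu => ?_) (by simp [hxa]) ?_ ⟨?_, ?_⟩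
    · exact ((h.hasDerivAt (show T < a - v by linarith [hv.2])).comp_const_sub a v).hasDerivWithinAt
    · have h2 := h.abs_deriv_sub_le hΔ (t₁ := a - u) (t₂ := a - v)
        (φ := fun t => forcing 1 Δ (betaSeq 1 Δ n) (a - t)) (by linarith [hu.2]) (by linarith)
        (by simpa using (hβ.intervalIntegrable_forcing hΔ (a - (a - u))
          (a - (a - v))).comp_sub_left a)
        fun t ht θ hθ => h.abs_le_forcing hΔ ha hx hxa hpos hβ ih
          ⟨by linarith [ht.1, hu.2], by linarith [ht.2, hv.1]⟩ hθ
      rw [intervalIntegral.integral_comp_sub_left (fun v => forcing 1 Δ (betaSeq 1 Δ n) v) a,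
        sub_sub_cancel, sub_sub_cancel] at h2
      linarith [(abs_le.1 h2).1]
    · rcases le_total (ξ - a) (hitLength 1 Δ (betaSeq 1 Δ n)) with h2 | h2
      · left
        rw [he, min_eq_left h2, show a - -(ξ - a) = ξ by ring, hξ, neg_zero]
      · right
        rw [he, min_eq_right h2]
        exact ⟨rfl, hx1 _ ⟨by linarith, by linarith⟩⟩
    · rw [he]
      rcases min_choice (ξ - a) (hitLength 1 Δ (betaSeq 1 Δ n)) with h2 | h2 <;> rw [h2]
      · linarith [ht.2]
      · exact h1
    · linarith [ht.1]

lemma DelayIneq.le_doubleIntegral (h : DelayIneq Δ T x x') (hΔ : 0 ≤ Δ) {a ξ : ℝ}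
    (ha : T + Δ + firstZero Δ ≤ a) (haξ : a ≤ ξ) (hx : ∀ t ∈ Icc T ξ, |x t| ≤ 1) (hxa : x a = 0)
    (hpos : ∀ t ∈ Icc a ξ, 0 ≤ x t) (hξ : x' ξ = 0) (n : ℕ) :
    x ξ ≤ doubleIntegral 1 Δ (betaSeq 1 Δ n) (-(ξ - a)) := by
  have hϑ := firstZero_pos hΔ
  have hβ := isBarrier_betaSeq hΔ n
  rw [hβ.doubleIntegral_eq hΔ]
  exact h.le_integral hΔ (by linarith) (by linarith) haξ hxa hξ
    (hβ.intervalIntegrable_forcing hΔ) fun t ht θ hθ => h.abs_le_forcing hΔ ha hx hxa hpos hβ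
      (h.le_betaSeq hΔ ha haξ hx hxa hpos hξ n) ht hθ

/-! ### Semicycles -/

lemma exists_isSemicycle (hc : ContinuousOn x (Ici T)) {z₀ z₁ t : ℝ} (hT : T ≤ z₀)
    (h0 : z₀ ≤ t) (h1 : t ≤ z₁) (hz₀ : x z₀ = 0) (hz₁ : x z₁ = 0) (ht : x t ≠ 0) :
    ∃ a b, IsSemicycle (Ici T) x a b ∧ z₀ ≤ a ∧ b ≤ z₁ ∧ t ∈ Ioo a b := by
  have hcl : ∀ u w, T ≤ u → IsCompact (Icc u w ∩ x ⁻¹' {0}) := fun u w hu =>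
    isCompact_Icc.of_isClosed_subset
      ((hc.mono fun y hy => hu.trans hy.1).preimage_isClosed_of_isClosed isClosed_Icc
        isClosed_singleton) inter_subset_left
  obtain ⟨a, ⟨ha, hxa⟩, hmax⟩ := (hcl z₀ t hT).exists_isGreatest ⟨z₀, ⟨le_rfl, h0⟩, hz₀⟩
  obtain ⟨b, ⟨hb, hxb⟩, hmin⟩ := (hcl t z₁ (hT.trans h0)).exists_isLeast ⟨z₁, ⟨h1, le_rfl⟩, hz₁⟩
  have hat : a < t := ha.2.lt_of_ne fun h => ht (h ▸ hxa)
  have htb : t < b := hb.1.lt_of_ne fun h => ht (h ▸ hxb)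
  refine ⟨a, b, ⟨hT.trans ha.1, hT.trans (h0.trans hb.1), hat.trans htb, hxa, hxb,
    fun u hu hxu => ?_⟩, ha.1, hb.2, hat, htb⟩
  rcases le_total u t with h | h
  · exact absurd (hmax ⟨⟨ha.1.trans hu.1.le, h⟩, hxu⟩) (not_le.2 hu.1)
  · exact absurd (hmin ⟨⟨h, hu.2.le.trans hb.2⟩, hxu⟩) (not_le.2 hu.2)

/-- A semicycle is positive after multiplication with a sign. -/
lemma IsSemicycle.exists_sign {a b : ℝ} (hs : IsSemicycle (Ici T) x a b)
    (hc : ContinuousOn x (Ici T)) : ∃ ε : ℝ, |ε| = 1 ∧ ∀ t ∈ Ioo a b, ε * x t = |x t| := by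
  obtain ⟨haT, -, -, -, -, hne⟩ := hs
  have hc' : ContinuousOn x (Ioo a b) := hc.mono fun t ht => haT.trans ht.1.le
  by_cases hpos : ∀ t ∈ Ioo a b, 0 ≤ x t
  · exact ⟨1, abs_one, fun t ht => by rw [one_mul, abs_of_nonneg (hpos t ht)]⟩
  · push Not at hpos
    obtain ⟨t, ht, hlt⟩ := hpos
    refine ⟨-1, by simp, fun u hu => ?_⟩
    rw [abs_of_nonpos, neg_one_mul]
    by_contra! hlt'
    obtain ⟨w, hw, hw0⟩ := isPreconnected_Ioo.intermediate_value ht hu hc' ⟨hlt.le, hlt'.le⟩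
    exact hne w hw hw0

/-- Rescaling turns a statement about a semicycle into one about a positive semicycle of a
solution bounded by `1`. -/
lemma IsSemicycle.exists_normalization (h : DelayIneq Δ T x x') {a b m : ℝ}
    (hs : IsSemicycle (Ici T) x a b) (hm : 0 < m) :
    ∃ y y' : ℝ → ℝ, DelayIneq Δ T y y' ∧ y a = 0 ∧ y b = 0 ∧ (∀ t ∈ Ioo a b, 0 < y t) ∧
      ∀ t, |y t| = m⁻¹ * |x t| := by
  obtain ⟨ε, hε, hεx⟩ := hs.exists_sign h.continuousOn
  obtain ⟨-, -, -, hxa, hxb, hne⟩ := hs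
  refine ⟨_, _, h.const_mul (m⁻¹ * ε), by simp [hxa], by simp [hxb], fun t ht => ?_, fun t => ?_⟩
  · rw [mul_assoc, hεx t ht]
    exact mul_pos (inv_pos.2 hm) (abs_pos.2 (hne t ht))
  · rw [abs_mul, abs_mul, hε, mul_one, abs_of_pos (inv_pos.2 hm)]

lemma DelayIneq.exists_max (h : DelayIneq Δ T x x') {a b : ℝ} (hTa : T ≤ a) (hab : a < b)
    (hxa : x a = 0) (hxb : x b = 0) (hpos : ∀ t ∈ Ioo a b, 0 < x t) :
    ∃ ξ ∈ Ioo a b, x' ξ = 0 ∧ ∀ t ∈ Icc a b, x t ≤ x ξ := by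
  obtain ⟨ξ, hξ, hmax⟩ := isCompact_Icc.exists_isMaxOn (nonempty_Icc.2 hab.le)
    (h.continuousOn.mono fun t (ht : t ∈ Icc a b) => hTa.trans ht.1)
  have hpos' : 0 < x ξ := by
    have hm : (a + b) / 2 ∈ Ioo a b := ⟨by linarith, by linarith⟩
    exact (hpos _ hm).trans_le (hmax (Ioo_subset_Icc_self hm))
  have hξ' : ξ ∈ Ioo a b :=
    ⟨hξ.1.lt_of_ne fun he => by rw [← he, hxa] at hpos'; exact lt_irrefl _ hpos',
      hξ.2.lt_of_ne fun he => by rw [he, hxb] at hpos'; exact lt_irrefl _ hpos'⟩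
  refine ⟨ξ, hξ', ?_, hmax⟩
  exact (hmax.isLocalMax (Icc_mem_nhds hξ'.1 hξ'.2)).hasDerivAt_eq_zero
    (h.hasDerivAt (hTa.trans_lt hξ'.1))

/-! ### Short semicycles contract -/

/-- There is a common contraction factor for all semicycles shorter than `c < Ψ + ϑ`: for suitable
`n` and `l < ϖ_n`, either the rising part is shorter than `l`, or the falling part is shorter than
`c - l < ϑ`. -/
lemma exists_contraction (hΔ : 0 ≤ Δ) {c : ℝ} (hc : c < Psi 1 Δ + firstZero Δ) :
    ∃ q : ℝ, 0 ≤ q ∧ q < 1 ∧ ∀ (T : ℝ) (x x' : ℝ → ℝ), DelayIneq Δ T x x' → ∀ a b M : ℝ,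
      T + Δ + firstZero Δ ≤ a → IsSemicycle (Ici T) x a b → b - a < c →
      (∀ t ∈ Icc T b, |x t| ≤ M) → ∀ t ∈ Icc a b, |x t| ≤ q * M := by
  have hϑ := firstZero_pos hΔ
  obtain ⟨n, hn⟩ := ((tendsto_varpi hΔ).eventually
    (lt_mem_nhds (show c - firstZero Δ < Psi 1 Δ by linarith))).exists
  have hnpos := varpi_pos hΔ n
  obtain ⟨l, hl, hln⟩ := exists_between (max_lt hn hnpos)
  obtain ⟨hlc, hl0⟩ := max_lt_iff.1 hl
  have hβ := isBarrier_betaSeq hΔ n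
  -- the two candidates for the contraction factor
  set D := fun w => doubleIntegral 1 Δ (betaSeq 1 Δ n) (-w) with hD
  have hDl : D l < 1 := by
    by_contra! hge
    exact absurd (varpi_le_of_one_le hΔ n hl0.le hge) (not_le.2 hln)
  have hDmono : ∀ w ∈ Icc 0 l, D w ≤ D l := fun w hw => by
    simp only [hD, hβ.doubleIntegral_eq hΔ]
    have hi := hβ.intervalIntegrable_mul_forcing hΔ
    rw [← intervalIntegral.integral_add_adjacent_intervals (hi (-l) (-w)) (hi (-w) 0)]
    have : 0 ≤ ∫ v in (-l)..(-w), -v * forcing 1 Δ (betaSeq 1 Δ n) v :=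
      intervalIntegral.integral_nonneg (by linarith [hw.2]) fun v hv =>
        mul_nonneg (by linarith [hv.2, hw.1]) (hβ.forcing_nonneg Δ (by linarith [hv.2, hw.1]))
    linarith
  have hD0 : 0 ≤ D l := by
    have := hDmono 0 ⟨le_rfl, hl0.le⟩
    simpa [hD, doubleIntegral_zero] using this
  have hm : 0 ≤ max (c - l) 0 := le_max_right _ _
  have hmϑ : max (c - l) 0 < firstZero Δ := max_lt (by linarith) hϑ
  have hr1 : comparisonSol Δ (firstZero Δ - max (c - l) 0) < 1 :=
    comparisonSol_lt_one hΔ (by linarith) (by linarith)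
  refine ⟨max (D l) (comparisonSol Δ (firstZero Δ - max (c - l) 0)), le_max_of_le_left hD0,
    max_lt hDl hr1, fun T x x' h a b M ha hs hbc hM t ht => ?_⟩
  have hab : a < b := hs.2.2.1
  have hTa : T ≤ a := by linarith
  have hne := hs.2.2.2.2.2 ((a + b) / 2) ⟨by linarith, by linarith⟩
  have hM0 : 0 < M := (abs_pos.2 hne).trans_le (hM _ ⟨by linarith, by linarith⟩)
  obtain ⟨y, y', hy, hya, hyb, hypos, hyx⟩ := hs.exists_normalization h hM0
  obtain ⟨ξ, hξ, hξ', hmax⟩ := hy.exists_max hTa hab hya hyb hypos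
  have hy1 : ∀ t ∈ Icc T b, |y t| ≤ 1 := fun t ht => by
    rw [hyx, inv_mul_le_iff₀ hM0, mul_one]; exact hM t ht
  have hy0 : ∀ t ∈ Icc a b, 0 ≤ y t := fun t ht => by
    rcases ht.1.eq_or_lt with he | hlt
    · rw [← he, hya]
    · rcases ht.2.eq_or_lt with he | hlt'
      · rw [he, hyb]
      · exact (hypos t ⟨hlt, hlt'⟩).le
  have hyξ : y ξ ≤ max (D l) (comparisonSol Δ (firstZero Δ - max (c - l) 0)) := by
    rcases le_total (ξ - a) l with h1 | h1
    · refine le_max_of_le_left (le_trans ?_ (hDmono (ξ - a) ⟨by linarith [hξ.1], h1⟩))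
      exact hy.le_doubleIntegral hΔ ha hξ.1.le
        (fun t ht => hy1 t ⟨ht.1, ht.2.trans hξ.2.le⟩) hya
        (fun t ht => hy0 t ⟨ht.1, ht.2.trans hξ.2.le⟩) hξ' n
    · refine le_max_of_le_right (((le_abs_self _).trans (hy.abs_le_comparisonSol hΔ (a := b)
        (by linarith) hy1 hyb ξ ⟨by linarith [hξ.1], hξ.2.le⟩)).trans
        (antitoneOn_comparisonSol hΔ ?_ ?_ ?_))
      · exact mem_Iic.2 (by linarith)
      · exact mem_Iic.2 (by linarith [hξ.2])
      · linarith [le_max_left (c - l) 0]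
  have hyt := (abs_of_nonneg (hy0 t ht)).trans_le ((hmax t ht).trans hyξ)
  rwa [hyx, inv_mul_le_iff₀ hM0, mul_comm] at hyt

/-! ### Growing semicycles are long -/

/-- If `|x|` attains its maximum over `[T, b]` in the semicycle `(a, b)` and is strictly smaller
before, then `b - a > Ψ + ϑ`. The falling part has length at least `ϑ`. In the rising part, just
after the zero `a`, the forcing exceeds all values that the delay can reach by a fixed amount,
because `r_Δ (ϑ - Δ) > 0`; this makes the rising part longer than all `ϖ_n` by a fixed amount. -/
lemma DelayIneq.lt_sub_of_isMax (h : DelayIneq Δ T x x') (hΔ : 0 < Δ) {a b ξ M : ℝ}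
    (ha : T + Δ + firstZero Δ ≤ a) (hξ : ξ ∈ Ioo a b) (hxa : x a = 0) (hxb : x b = 0)
    (hpos : ∀ t ∈ Ioo a b, 0 < x t) (hx : ∀ t ∈ Icc T b, |x t| ≤ 1) (hxξ : x ξ = 1)
    (hM : M < 1) (hxM : ∀ t ∈ Icc T a, |x t| ≤ M) : Psi 1 Δ + firstZero Δ < b - a := by
  obtain ⟨hξa, hξb⟩ := hξ
  have hϑ := firstZero_pos hΔ.le
  have hTa : T < a := by linarith
  have hξ' : x' ξ = 0 := by
    refine IsLocalMax.hasDerivAt_eq_zero ?_ (h.hasDerivAt (hTa.trans hξa))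
    filter_upwards [Icc_mem_nhds (hTa.trans hξa) hξb] with t ht
    rw [hxξ]
    exact (le_abs_self _).trans (hx t ht)
  have hfall : firstZero Δ ≤ b - ξ := by
    by_contra! hlt
    have h1 := h.abs_le_comparisonSol hΔ.le (by linarith) hx hxb ξ ⟨by linarith, hξb.le⟩
    rw [hxξ, abs_one] at h1
    exact absurd h1 (not_le.2 (comparisonSol_lt_one hΔ.le (by linarith) (by linarith)))
  have hxξ1 : ∀ t ∈ Icc T ξ, |x t| ≤ 1 := fun t ht => hx t ⟨ht.1, ht.2.trans hξb.le⟩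
  have hxpos : ∀ t ∈ Icc a ξ, 0 ≤ x t := fun t ht =>
    ht.1.eq_or_lt.elim (fun he => by rw [← he, hxa])
      fun hlt => (hpos t ⟨hlt, ht.2.trans_lt hξb⟩).le
  set ℓ := ξ - a with hℓ
  have hℓ0 : 0 < ℓ := by linarith
  -- near `a` the forcing exceeds the reachable values by `δ`
  set ρ := comparisonSol Δ (firstZero Δ - Δ / 2) with hρ
  have hρ0 : 0 < ρ := comparisonSol_pos hΔ.le (by linarith)
  have hM1 : max M (1 / 2) < 1 := max_lt hM (by norm_num)
  have hM0 : 0 < max M (1 / 2) := lt_max_of_lt_right (by norm_num)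
  obtain ⟨η₀, hη₀, hη₀x⟩ : ∃ η₀ > 0, ∀ t, |t - a| < η₀ → |x t| < ρ / 2 := by
    have hc := Metric.continuousAt_iff.1 (h.hasDerivAt hTa).continuousAt (ρ / 2) (by positivity)
    simpa [Real.dist_eq, hxa] using hc
  set η := min (η₀ / 2) (min (Δ / 2) ℓ) with hη
  have hη0 : 0 < η := lt_min (by positivity) (lt_min (by positivity) hℓ0)
  have hη1 : η ≤ η₀ / 2 := min_le_left _ _
  have hη2 : η ≤ Δ / 2 := (min_le_right _ _).trans (min_le_left _ _)
  have hη3 : η ≤ ℓ := (min_le_right _ _).trans (min_le_right _ _)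
  set δ := min (ρ / 2) ((1 - max M (1 / 2)) * ρ) with hδ
  have hδ0 : 0 < δ := lt_min (by positivity) (mul_pos (by linarith) hρ0)
  have hgap : ∀ β, IsBarrier β → ∀ t ∈ Icc a ξ, t ≤ a + η → ∀ θ ∈ Icc (t - Δ) t,
      |x θ| ≤ forcing 1 Δ β (a - t) - δ := by
    intro β hβ t ht htη θ hθ
    have hv : a - t ∈ Icc (-Δ) 0 := ⟨by linarith, by linarith [ht.1]⟩
    have hf := comparisonSol_le_forcing β hv
    have hρf : ρ ≤ comparisonSol Δ (firstZero Δ - (a - t) - Δ) :=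
      antitoneOn_comparisonSol hΔ.le (mem_Iic.2 (by linarith [hv.1])) (mem_Iic.2 (by linarith))
        (by linarith)
    rcases le_or_gt a θ with h1 | h1
    · have h2 := hη₀x θ (by rw [abs_of_nonneg (by linarith)]; linarith [hθ.2])
      linarith [min_le_left (ρ / 2) ((1 - max M (1 / 2)) * ρ)]
    · have h2 := h.abs_le_mul_comparisonSol hΔ.le hM0 ha
        (fun t ht => (hxM t ht).trans (le_max_left _ _)) hxa
        (t := θ) ⟨by linarith [hθ.1, ht.1], h1.le⟩
      have h3 : comparisonSol Δ (firstZero Δ - (a - θ)) ≤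
          comparisonSol Δ (firstZero Δ - (a - t) - Δ) :=
        antitoneOn_comparisonSol hΔ.le (mem_Iic.2 (by linarith [hv.1]))
          (mem_Iic.2 (by linarith)) (by linarith [hθ.1])
      have h4 := mul_le_mul_of_nonneg_left h3 hM0.le
      have h5 := mul_le_mul_of_nonneg_left hρf (by linarith : 0 ≤ 1 - max M (1 / 2))
      linarith [min_le_right (ρ / 2) ((1 - max M (1 / 2)) * ρ)]
  -- a continuous function below `δ` times the indicator function of `[-η, 0]`
  set k : ℝ → ℝ := fun v => δ * max (1 + v / η) 0 with hk
  have hkc : Continuous k := by fun_prop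
  have hkδ : ∀ v ≤ 0, k v ≤ δ := fun v hv => by
    have h1 : max (1 + v / η) 0 ≤ 1 :=
      max_le (by linarith [div_nonpos_of_nonpos_of_nonneg hv hη0.le]) zero_le_one
    exact mul_le_of_le_one_right hδ0.le h1
  have hk0 : ∀ v ≤ -η, k v = 0 := fun v hv => by
    have h1 : v / η ≤ -1 := by rw [div_le_iff₀ hη0]; linarith
    simp only [hk]
    rw [max_eq_right (by linarith), mul_zero]
  have hknn : ∀ v, 0 ≤ k v := fun v => mul_nonneg hδ0.le (le_max_right _ _)
  set κ := ∫ v in (-ℓ)..0, -v * k v with hκ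
  have hκ0 : 0 < κ := by
    refine intervalIntegral.integral_pos (by linarith) (by fun_prop)
      (fun v hv => mul_nonneg (by linarith [hv.2]) (hknn v))
      ⟨-(η / 2), ⟨by linarith, by linarith⟩, ?_⟩
    have h1 : -(η / 2) / η = -(1 / 2) := by field_simp
    simp only [hk, h1]
    refine mul_pos (by linarith) (mul_pos hδ0 (lt_max_of_lt_left (by norm_num)))
  have hD : ∀ n, 1 + κ ≤ doubleIntegral 1 Δ (betaSeq 1 Δ n) (-ℓ) := fun n => by
    have hβ := isBarrier_betaSeq hΔ.le n
    have hi := hβ.intervalIntegrable_forcing hΔ.le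
    have h1 := h.le_integral hΔ.le (by linarith) hTa hξa.le hxa hξ'
      (ψ := fun v => forcing 1 Δ (betaSeq 1 Δ n) v - k v)
      (fun a b => (hi a b).sub (hkc.intervalIntegrable a b)) fun t ht θ hθ => by
        rcases le_total t (a + η) with h2 | h2
        · linarith [hgap _ hβ t ht h2 θ hθ, hkδ (a - t) (by linarith [ht.1])]
        · rw [hk0 (a - t) (by linarith), sub_zero]
          exact h.abs_le_forcing hΔ.le ha hxξ1 hxa hxpos hβ
            (h.le_betaSeq hΔ.le ha hξa.le hxξ1 hxa hxpos hξ' n) ht hθ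
    simp only [mul_sub] at h1
    rw [intervalIntegral.integral_sub (hβ.intervalIntegrable_mul_forcing hΔ.le _ _)
      ((by fun_prop : Continuous fun v => -v * k v).intervalIntegrable _ _),
      ← hβ.doubleIntegral_eq hΔ.le, hxξ] at h1
    linarith
  have hϖ : ∀ n, varpi 1 Δ n ≤ ℓ - κ / ℓ := fun n => by
    have hβ := isBarrier_betaSeq hΔ.le n
    have hle : varpi 1 Δ n ≤ ℓ := varpi_le_of_one_le hΔ.le n hℓ0.le (by linarith [hD n])
    have h1 : doubleIntegral 1 Δ (betaSeq 1 Δ n) (-varpi 1 Δ n) = 1 :=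
      (hβ.hitLength_spec hΔ.le).2.1
    have hi := hβ.intervalIntegrable_mul_forcing hΔ.le
    have h2 := hD n
    have hpos := varpi_pos hΔ.le n
    rw [hβ.doubleIntegral_eq hΔ.le, ← intervalIntegral.integral_add_adjacent_intervals
      (hi (-ℓ) (-varpi 1 Δ n)) (hi (-varpi 1 Δ n) 0), ← hβ.doubleIntegral_eq hΔ.le, h1] at h2
    have h3 : ∫ v in (-ℓ)..(-varpi 1 Δ n), -v * forcing 1 Δ (betaSeq 1 Δ n) v ≤
        ∫ v in (-ℓ)..(-varpi 1 Δ n), ℓ :=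
      intervalIntegral.integral_mono_on (by linarith) (hi _ _) intervalIntegrable_const
        fun v hv => by
          have h0 : v ≤ 0 := by linarith [hv.2]
          have := mul_le_mul (show -v ≤ ℓ by linarith [hv.1]) (hβ.forcing_le_one hΔ.le h0)
            (hβ.forcing_nonneg Δ h0) hℓ0.le
          linarith
    rw [intervalIntegral.integral_const, smul_eq_mul] at h3
    have h4 : κ / ℓ ≤ ℓ - varpi 1 Δ n := by
      rw [div_le_iff₀ hℓ0]; linarith
    linarith
  have hΨ := le_of_tendsto' (tendsto_varpi hΔ.le) hϖ
  have : 0 < κ / ℓ := div_pos hκ0 hℓ0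
  linarith

/-- Without delay no semicycle is shorter than `π`: multiply `x'' ≥ -x` by
`sin (π (t - a) / (b - a))` and integrate by parts twice. -/
lemma DelayIneq.pi_le_sub (h : DelayIneq 0 T x x') {a b : ℝ} (ha : T ≤ a) (hab : a < b)
    (hxa : x a = 0) (hxb : x b = 0) (hpos : ∀ t ∈ Ioo a b, 0 < x t) : Real.pi ≤ b - a := by
  by_contra! hlt
  have hba : 0 < b - a := by linarith
  set k := Real.pi / (b - a) with hk
  have hk1 : 1 < k := (one_lt_div hba).2 hlt
  have hsub : uIcc a b ⊆ uIcc T b := by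
    rw [uIcc_of_le hab.le, uIcc_of_le (ha.trans hab.le)]; exact Icc_subset_Icc_left ha
  have hac := (h.ac b (ha.trans hab.le)).mono hsub
  have hac' := (h.ac' b (ha.trans hab.le)).mono hsub
  set φ : ℝ → ℝ := fun t => Real.sin (k * (t - a)) with hφ
  set φ' : ℝ → ℝ := fun t => k * Real.cos (k * (t - a)) with hφ'
  have hlin : ∀ t, HasDerivAt (fun t => k * (t - a)) k t := fun t => by
    simpa using ((hasDerivAt_id t).sub_const a).const_mul k
  have hd : deriv φ = φ' := funext fun t => by
    rw [((hlin t).sin).deriv, mul_comm]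
  have hd' : deriv φ' = fun t => -k ^ 2 * φ t := funext fun t => by
    rw [((hlin t).cos.const_mul k).deriv]; simp only [hφ]; ring
  have hφac : AbsolutelyContinuousOnInterval φ a b :=
    (by fun_prop : ContDiff ℝ 1 φ).contDiffOn.absolutelyContinuousOnInterval
  have hφac' : AbsolutelyContinuousOnInterval φ' a b :=
    (by fun_prop : ContDiff ℝ 1 φ').contDiffOn.absolutelyContinuousOnInterval
  have hφa : φ a = 0 := by simp [hφ]
  have hφb : φ b = 0 := by
    simp only [hφ, hk]
    rw [div_mul_cancel₀ _ hba.ne', Real.sin_pi]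
  have h1 := hφac.integral_mul_deriv_eq_deriv_mul hac'
  have h2 := hφac'.integral_mul_deriv_eq_deriv_mul hac
  have h3 : ∫ t in a..b, φ' t * deriv x t = ∫ t in a..b, φ' t * x' t :=
    intervalIntegral.integral_congr_ae <| Eventually.of_forall fun t ht => by
      rw [uIoc_of_le hab.le] at ht
      rw [(h.hasDerivAt (ha.trans_lt ht.1)).deriv]
  rw [h3, hd', hxa, hxb] at h2
  rw [hd, hφa, hφb, h2] at h1
  have hφ0 : ∀ t ∈ Ioo a b, 0 < φ t := fun t ht => by
    refine Real.sin_pos_of_pos_of_lt_pi (mul_pos (by linarith) (by linarith [ht.1])) ?_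
    rw [hk, div_mul_eq_mul_div, div_lt_iff₀ hba]
    exact mul_lt_mul_of_pos_left (by linarith [ht.2]) Real.pi_pos
  have hφc : ContinuousOn φ (uIcc a b) := hφac.continuousOn
  have hi : IntervalIntegrable (fun t => φ t * x t) volume a b :=
    (hφc.mul hac.continuousOn).intervalIntegrable
  have h4 : 0 < ∫ t in a..b, φ t * x t :=
    intervalIntegral.intervalIntegral_pos_of_pos_on hi
      (fun t ht => mul_pos (hφ0 t ht) (hpos t ht)) hab
  have h5 : ∫ t in a..b, -(φ t * x t) ≤ ∫ t in a..b, φ t * deriv x' t := by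
    refine intervalIntegral.integral_mono_ae_restrict hab.le hi.neg
      (hac'.intervalIntegrable_deriv.continuousOn_mul hφc) ?_
    rw [← Measure.restrict_congr_set Ioo_ae_eq_Icc]
    refine (ae_restrict_iff' measurableSet_Ioo).2 ?_
    filter_upwards [h.ineq] with t ht htI
    obtain ⟨θ, hθ, hle⟩ := ht (by linarith [htI.1])
    have hθt : θ = t := le_antisymm hθ.2 (by linarith [hθ.1])
    rw [hθt, abs_of_pos (hpos t htI)] at hle
    have := mul_le_mul_of_nonneg_left (abs_le.1 hle).1 (hφ0 t htI).le
    linarith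
  have h6 : ∫ t in a..b, -k ^ 2 * φ t * x t = -k ^ 2 * ∫ t in a..b, φ t * x t := by
    rw [← intervalIntegral.integral_const_mul]
    exact intervalIntegral.integral_congr fun t _ => mul_assoc _ _ _
  rw [h6] at h1
  rw [intervalIntegral.integral_neg, h1] at h5
  have h7 : 0 < (k ^ 2 - 1) * ∫ t in a..b, φ t * x t := mul_pos (by nlinarith) h4
  linarith

/-! ### Boundedness and convergence -/

/-- An unbounded oscillatory function attains its running maximum for the first time inside some
semicycle that begins as late as desired. -/
lemma bounded_of_forall_isSemicycle (hc : ContinuousOn x (Ici T))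
    (hosc : IsOscillatory (Ici T) x) (S : ℝ)
    (H : ∀ a b ξ m M, S ≤ a → IsSemicycle (Ici T) x a b → ξ ∈ Ioo a b → |x ξ| = m → 0 < m →
      (∀ t ∈ Icc T b, |x t| ≤ m) → M < m → (∀ t ∈ Icc T a, |x t| ≤ M) → False) :
    ∃ C, ∀ t ∈ Ici T, |x t| ≤ C := by
  obtain ⟨t₁, ht₁T, ht₁S, hxt₁⟩ := hosc S
  have hca : ∀ b, ContinuousOn (fun t => |x t|) (Icc T b) := fun b =>
    (hc.mono Icc_subset_Ici_self).abs
  obtain ⟨z, hz, hzmax⟩ := isCompact_Icc.exists_isMaxOn (nonempty_Icc.2 ht₁T) (hca t₁)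
  refine ⟨|x z|, fun t ht => ?_⟩
  by_contra! hlt
  obtain ⟨b₀, hb₀T, hb₀t, hxb₀⟩ := hosc t
  obtain ⟨w, hw, hwmax⟩ := isCompact_Icc.exists_isMaxOn (nonempty_Icc.2 hb₀T) (hca b₀)
  have hcl : IsCompact (Icc T b₀ ∩ (fun t => |x t|) ⁻¹' {|x w|}) :=
    isCompact_Icc.of_isClosed_subset
      ((hca b₀).preimage_isClosed_of_isClosed isClosed_Icc isClosed_singleton) inter_subset_left
  obtain ⟨ξ, ⟨hξ, hξw⟩, hmin⟩ := hcl.exists_isLeast ⟨w, hw, rfl⟩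
  have hξw : |x ξ| = |x w| := hξw
  have hzw : |x z| < |x w| := hlt.trans_le (hwmax ⟨ht, hb₀t⟩)
  have ht₁ξ : t₁ ≤ ξ := by
    by_contra! hc
    have h1 : |x ξ| ≤ |x z| := hzmax ⟨hξ.1, hc.le⟩
    linarith
  have hxξ : x ξ ≠ 0 := fun h0 => by
    rw [h0, abs_zero] at hξw
    linarith [abs_nonneg (x z)]
  obtain ⟨a, b, hs, hta, hbb, hξab⟩ :=
    exists_isSemicycle hc ht₁T ht₁ξ hξ.2 hxt₁ hxb₀ hxξ
  obtain ⟨u, hu, humax⟩ := isCompact_Icc.exists_isMaxOn (nonempty_Icc.2 hs.1) (hca a)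
  have hub : u ∈ Icc T b₀ := ⟨hu.1, by linarith [hu.2, hξab.1, hξ.2]⟩
  refine H a b ξ |x w| |x u| (ht₁S.trans hta) hs hξab hξw
    ((abs_nonneg _).trans_lt hzw) (fun t ht => hwmax ⟨ht.1, ht.2.trans hbb⟩) ?_ humax
  refine lt_of_le_of_ne (hwmax hub) fun he => ?_
  exact absurd (hmin ⟨hub, he⟩) (not_le.2 (hu.2.trans_lt hξab.1))

lemma IsSolution.exists_delayIneq {p τ : ℝ → ℝ} (hτ_nonneg : ∀ t, 0 ≤ τ t)
    (hτ_bdd : ∃ C : ℝ, ∀ᵐ t : ℝ, τ t ≤ C) (hp_le : ∀ᵐ t : ℝ, |p t| ≤ 1) {s : ℝ}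
    (hx : IsSolution p τ s x) :
    0 ≤ maxDelay τ s ∧ ∃ x', DelayIneq (maxDelay τ s) (s - maxDelay τ s) x x' := by
  obtain ⟨C, hC⟩ := hτ_bdd
  have hle : ∀ᵐ t ∂volume.restrict (Ici s), τ t ≤ maxDelay τ s :=
    ae_le_essSup ⟨C, ae_restrict_of_ae hC⟩
  have h0 : 0 ≤ maxDelay τ s := by
    have : NeBot (ae (volume.restrict (Ici s))) := by
      rw [ae_neBot, Ne, Measure.restrict_eq_zero]; simp
    obtain ⟨t, ht⟩ := hle.exists
    exact (hτ_nonneg t).trans ht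
  obtain ⟨x', hd, hac, hac', hode⟩ := hx
  refine ⟨h0, x', hd, hac, hac', ?_⟩
  rw [ae_restrict_iff' measurableSet_Ici] at hle hode
  filter_upwards [hle, hode, hp_le] with t h1 h2 h3 ht
  have hts : t ∈ Ici s := by simpa using ht
  refine ⟨t - τ t, ⟨by linarith [h1 hts], by linarith [hτ_nonneg t]⟩, ?_⟩
  rw [(h2 hts).deriv, abs_neg, abs_mul]
  exact mul_le_of_le_one_left (abs_nonneg _) h3

lemma DelayIneq.bounded_of_forall_le (h : DelayIneq Δ T x x') (hΔ : 0 < Δ)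
    (hosc : IsOscillatory (Ici T) x)
    (H : ∀ a b, IsSemicycle (Ici T) x a b → b - a ≤ Psi 1 Δ + firstZero Δ) :
    ∃ C, ∀ t ∈ Ici T, |x t| ≤ C := by
  refine bounded_of_forall_isSemicycle h.continuousOn hosc (T + Δ + firstZero Δ)
    fun a b ξ m M ha hs hξ hm hm0 hxm hMm hxM => ?_
  obtain ⟨y, y', hy, hya, hyb, hypos, hyx⟩ := hs.exists_normalization h hm0
  refine absurd (H a b hs) (not_le.2 (hy.lt_sub_of_isMax hΔ (M := m⁻¹ * M) ha hξ hya hyb hypos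
    (fun t ht => ?_) ?_ ?_ fun t ht => ?_))
  · rw [hyx, inv_mul_le_iff₀ hm0, mul_one]; exact hxm t ht
  · rw [← abs_of_pos (hypos ξ hξ), hyx, hm, inv_mul_cancel₀ hm0.ne']
  · rwa [inv_mul_lt_iff₀ hm0, mul_one]
  · rw [hyx]; exact mul_le_mul_of_nonneg_left (hxM t ht) (inv_nonneg.2 hm0.le)

lemma DelayIneq.bounded_of_forall_lt_pi (h : DelayIneq 0 T x x')
    (hosc : IsOscillatory (Ici T) x)
    (H : ∀ a b, IsSemicycle (Ici T) x a b → b - a < Real.pi) :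
    ∃ C, ∀ t ∈ Ici T, |x t| ≤ C := by
  refine bounded_of_forall_isSemicycle h.continuousOn hosc T
    fun a b ξ m M ha hs hξ hm hm0 hxm hMm hxM => ?_
  obtain ⟨y, y', hy, hya, hyb, hypos, -⟩ := hs.exists_normalization h hm0
  exact absurd (H a b hs) (not_lt.2 (hy.pi_le_sub ha hs.2.2.1 hya hyb hypos))

lemma DelayIneq.tendsto_zero (h : DelayIneq Δ T x x') (hΔ : 0 ≤ Δ)
    (hosc : IsOscillatory (Ici T) x) {c : ℝ} (hc : c < Psi 1 Δ + firstZero Δ)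
    (H : ∀ a b, IsSemicycle (Ici T) x a b → b - a < c) : Tendsto x atTop (𝓝 0) := by
  obtain ⟨q, hq0, hq1, hq⟩ := exists_contraction hΔ hc
  obtain ⟨C, hC⟩ := bounded_of_forall_isSemicycle h.continuousOn hosc (T + Δ + firstZero Δ)
    fun a b ξ m M ha hs hξ hm hm0 hxm _ _ => by
      have h1 := hq T x x' h a b m ha hs (H a b hs) hxm ξ (Ioo_subset_Icc_self hξ)
      rw [hm] at h1
      nlinarith
  have key : ∀ n : ℕ, ∃ S ≥ T, ∀ t ≥ S, |x t| ≤ q ^ n * C := by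
    intro n
    induction n with
    | zero => exact ⟨T, le_rfl, fun t ht => by simpa using hC t ht⟩
    | succ n ih =>
      obtain ⟨S, hST, hS⟩ := ih
      obtain ⟨t₁, ht₁T, ht₁, hxt₁⟩ := hosc (S + Δ + firstZero Δ)
      refine ⟨t₁, ht₁T, fun t ht => ?_⟩
      by_cases hxt : x t = 0
      · have h1 := hS t (by linarith [firstZero_pos hΔ])
        rw [hxt, abs_zero] at h1 ⊢
        rw [pow_succ, mul_right_comm]
        exact mul_nonneg h1 hq0
      obtain ⟨z, -, htz, hxz⟩ := hosc t
      obtain ⟨a, b, hs, hta, -, htab⟩ :=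
        exists_isSemicycle h.continuousOn ht₁T ht htz hxt₁ hxz hxt
      have hSa : S ≤ a := by linarith [firstZero_pos hΔ]
      have hs' : IsSemicycle (Ici S) x a b := ⟨hSa, hSa.trans hs.2.2.1.le, hs.2.2⟩
      have h1 := hq S x x' (h.mono hST) a b (q ^ n * C) (ht₁.trans hta) hs' (H a b hs)
        (fun u hu => hS u hu.1) t (Ioo_subset_Icc_self htab)
      rwa [← mul_assoc, ← pow_succ'] at h1
  have hlim : Tendsto (fun n : ℕ => q ^ n * C) atTop (𝓝 0) := by
    simpa using (tendsto_pow_atTop_nhds_zero_of_lt_one hq0 hq1).mul_const C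
  refine Metric.tendsto_atTop.2 fun ε hε => ?_
  obtain ⟨n, hn⟩ := (hlim.eventually (gt_mem_nhds hε)).exists
  obtain ⟨S, -, hS⟩ := key n
  exact ⟨S, fun t ht => by rw [Real.dist_eq, sub_zero]; exact (hS t ht).trans_lt hn⟩

end DelayEq


theorem theorem10p41 (p τ : ℝ → ℝ)
    (hp_meas : AEMeasurable p volume) (hτ_meas : AEMeasurable τ volume)
    (hτ_nonneg : ∀ t, 0 ≤ τ t) (hτ_bdd : ∃ C : ℝ, ∀ᵐ t : ℝ, τ t ≤ C)
    (hp_le : ∀ᵐ t : ℝ, |p t| ≤ 1)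
    (s : ℝ) (x : ℝ → ℝ) (hx : DelayEq.IsSolution p τ s x)
    (hosc : DelayEq.IsOscillatory (Ici (s - DelayEq.maxDelay τ s)) x) :
    ((0 < DelayEq.maxDelay τ s →
        ∀ a b : ℝ, DelayEq.IsSemicycle (Ici (s - DelayEq.maxDelay τ s)) x a b →
          b - a ≤ DelayEq.Psi 1 (DelayEq.maxDelay τ s)
            + DelayEq.firstZero (DelayEq.maxDelay τ s)) →
      (DelayEq.maxDelay τ s = 0 →
        ∀ a b : ℝ, DelayEq.IsSemicycle (Ici (s - DelayEq.maxDelay τ s)) x a b →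
          b - a < Real.pi) →
      ∃ C : ℝ, ∀ t ∈ Ici (s - DelayEq.maxDelay τ s), |x t| ≤ C) ∧
    (∀ c : ℝ, 0 < c →
      c < DelayEq.Psi 1 (DelayEq.maxDelay τ s) + DelayEq.firstZero (DelayEq.maxDelay τ s) →
      (∀ a b : ℝ, DelayEq.IsSemicycle (Ici (s - DelayEq.maxDelay τ s)) x a b → b - a < c) →
      Tendsto x atTop (𝓝 0)) := by
  obtain ⟨hΔ, x', h⟩ := hx.exists_delayIneq hτ_nonneg hτ_bdd hp_le
  refine ⟨fun hpos hzero => ?_, fun c _ hc H => h.tendsto_zero hΔ hosc hc H⟩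
  rcases hΔ.eq_or_lt with h0 | h0
  · refine DelayEq.DelayIneq.bounded_of_forall_lt_pi (x' := x') ?_ hosc (hzero h0.symm)
    rw [← h0] at h ⊢
    exact h
  · exact h.bounded_of_forall_le h0 hosc (hpos h0)
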